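/- Let $(M,g)$ be an oriented smooth Riemannian $4$-manifold with Levi-Civita connection $D$. A skew endomorphism $A$ of a tangent space is identified with the $2$-form $\langle A\cdot,\cdot\rangle$; the Hodge star $*$ thus acts on skew endomorphisms, and $A^-=\frac12(A-*A)$ is the antiselfdual part of $A$. Suppose that $g$ is selfdual Einstein, that is, $\mathrm{Ric}=c\,g$ for a constant $c$ and the antiselfdual part $W^-$ of the Weyl tensor vanishes, and that its scalar curvature is nonzero. A Killing field is a smooth vector field $K$ for which the endomorphism $DK\colon X\mapsto D_XK$ is skew at every point. An (antiselfdual) twistor is a smooth section $\Psi$ of the bundle of antiselfdual skew endomorphisms of $TM$ for which there is a smooth $1$-form $\gamma$ such that, for all tangent vectors $X$, $$D_X\Psi=(\gamma\vartriangle X)^-,\qquad\text{where } (\gamma\vartriangle X)(Y)=\gamma(Y)X-\langle X,Y\rangle\,\sharp\gamma$$ and $\sharp\gamma$ is the vector field dual to $\gamma$. Then $K\mapsto (DK)^-$ is a linear isomorphism from the space of Killing fields of $g$ onto the space of twistors. -/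

import Mathlib

open Bundle FiberBundle Manifold Module VectorField
open scoped ContDiff Topology

noncomputable section
namespace SelfdualEinstein

set_option linter.unusedSectionVars false
section LC
variable {E : Type*} [NormedAddCommGroup E] [NormedSpace ℝ E] [FiniteDimensional ℝ E]
  {H : Type*} [TopologicalSpace H] {I : ModelWithCorners ℝ E H}
  {M : Type*} [TopologicalSpace M] [ChartedSpace H M] [IsManifold I ∞ M]
  [RiemannianBundle (fun x : M ↦ TangentSpace I x)]
  [IsContMDiffRiemannianBundle I ∞ E (fun x : M ↦ TangentSpace I x)]

instance (x : M) : FiniteDimensional ℝ (TangentSpace I x) := inferInstanceAs (FiniteDimensional ℝ E)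

/-- The function `y ↦ g(X, Y)(y)` for two vector fields `X`, `Y`. -/
def metricFun (X Y : Π x : M, TangentSpace I x) (x : M) : ℝ := inner ℝ (X x) (Y x)

theorem metricFun_comm (X Y : Π x : M, TangentSpace I x) :
    metricFun X Y = metricFun Y X := by
  ext y; exact real_inner_comm _ _

theorem metricFun_smul (f : M → ℝ) (X Y : Π x : M, TangentSpace I x) :
    metricFun (f • X) Y = f * metricFun X Y := by
  ext y; simp [metricFun, inner_smul_left]

theorem metricFun_add (X X' Y : Π x : M, TangentSpace I x) :
    metricFun (X + X') Y = metricFun X Y + metricFun X' Y := by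
  ext y; simp [metricFun, inner_add_left]

theorem mdiff_metricFun {Y Z : Π x : M, TangentSpace I x} {x : M} (hY : MDiffAt (T% Y) x)
    (hZ : MDiffAt (T% Z) x) : MDiffAt (metricFun Y Z) x :=
  MDifferentiableAt.inner_bundle (IB := I) (F := E) (E := fun x : M ↦ TangentSpace I x) hY hZ

/-- The right hand side of the Koszul formula: half of
`X g(Y,Z) + Y g(Z,X) - Z g(X,Y) + g([X,Y],Z) - g([Y,Z],X) + g([Z,X],Y)`. -/
def koszul (X Y Z : Π x : M, TangentSpace I x) (x : M) : ℝ :=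
  2⁻¹ * (d% (metricFun Y Z) x (X x) + d% (metricFun Z X) x (Y x) - d% (metricFun X Y) x (Z x)
    + inner ℝ (mlieBracket I X Y x) (Z x) - inner ℝ (mlieBracket I Y Z x) (X x)
    + inner ℝ (mlieBracket I Z X x) (Y x))

theorem tensorialAt_koszul_left {Y Z : Π x : M, TangentSpace I x} {x : M} (hY : MDiffAt (T% Y) x)
    (hZ : MDiffAt (T% Z) x) : TensorialAt I E (fun X ↦ koszul X Y Z x) x where
  smul {f X} hf hX := by
    simp only [koszul, metricFun_comm Z, metricFun_smul]
    rw [mvfderiv_mul hf (mdiff_metricFun hX hZ), mvfderiv_mul hf (mdiff_metricFun hX hY),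
      mlieBracket_smul_left hf hX, mlieBracket_smul_right hf hX]
    simp [inner_add_left, inner_smul_left, inner_smul_right, metricFun]
    ring
  add {X X'} hX hX' := by
    simp only [koszul, metricFun_comm Z, metricFun_add]
    rw [mvfderiv_add (mdiff_metricFun hX hZ) (mdiff_metricFun hX' hZ),
      mvfderiv_add (mdiff_metricFun hX hY) (mdiff_metricFun hX' hY),
      mlieBracket_add_left hX hX', mlieBracket_add_right hX hX']
    simp [inner_add_left, inner_add_right]
    ring

theorem tensorialAt_koszul_right {X Y : Π x : M, TangentSpace I x} {x : M} (hX : MDiffAt (T% X) x)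
    (hY : MDiffAt (T% Y) x) : TensorialAt I E (fun Z ↦ koszul X Y Z x) x where
  smul {f Z} hf hZ := by
    simp only [koszul, metricFun_comm Y, metricFun_smul]
    rw [mvfderiv_mul hf (mdiff_metricFun hZ hY), mvfderiv_mul hf (mdiff_metricFun hZ hX),
      mlieBracket_smul_left hf hZ, mlieBracket_smul_right hf hZ]
    simp [inner_add_left, inner_smul_left, inner_smul_right, metricFun, real_inner_comm]
    ring
  add {Z Z'} hZ hZ' := by
    simp only [koszul, metricFun_comm Y, metricFun_add]
    rw [mvfderiv_add (mdiff_metricFun hZ hX) (mdiff_metricFun hZ' hX),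
      mvfderiv_add (mdiff_metricFun hZ hY) (mdiff_metricFun hZ' hY),
      mlieBracket_add_left hZ hZ', mlieBracket_add_right hZ hZ']
    simp [inner_add_left, inner_add_right]
    ring

open scoped Classical in
/-- For a vector field `Y` differentiable at `x`, the bilinear form `(X, Z) ↦ g(D_X Y, Z)` on `T_x M`
given by the Koszul formula. -/
def leviCivitaForm (Y : Π x : M, TangentSpace I x) (x : M) :
    TangentSpace I x →L[ℝ] TangentSpace I x →L[ℝ] ℝ :=
  if hY : MDiffAt (T% Y) x then
    TensorialAt.mkHom₂ (F := E) (F' := E) (fun X Z ↦ koszul X Y Z x) x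
      (fun _ hZ ↦ tensorialAt_koszul_left hY hZ) (fun _ hX ↦ tensorialAt_koszul_right hX hY)
  else 0

theorem leviCivitaForm_apply {X Y Z : Π x : M, TangentSpace I x} {x : M} (hX : MDiffAt (T% X) x)
    (hY : MDiffAt (T% Y) x) (hZ : MDiffAt (T% Z) x) :
    leviCivitaForm Y x (X x) (Z x) = koszul X Y Z x := by
  rw [leviCivitaForm, dif_pos hY]
  exact TensorialAt.mkHom₂_apply _ _ hX hZ

/-- The endomorphism `A` of `T_x M` with `g(A u, v) = B(u, v)`. -/
def sharpHom {x : M} (B : TangentSpace I x →L[ℝ] TangentSpace I x →L[ℝ] ℝ) :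
    TangentSpace I x →L[ℝ] TangentSpace I x :=
  ∑ i, (B.flip (stdOrthonormalBasis ℝ (TangentSpace I x) i)).smulRight
    (stdOrthonormalBasis ℝ (TangentSpace I x) i)

theorem inner_sharpHom {x : M} (B : TangentSpace I x →L[ℝ] TangentSpace I x →L[ℝ] ℝ)
    (u v : TangentSpace I x) : inner ℝ (sharpHom B u) v = B u v := by
  conv_rhs => rw [← (stdOrthonormalBasis ℝ (TangentSpace I x)).sum_repr' v]
  simp [sharpHom, sum_inner, inner_smul_left, mul_comm]

theorem eq_sharpHom {x : M} {A : TangentSpace I x →L[ℝ] TangentSpace I x}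
   {B : TangentSpace I x →L[ℝ] TangentSpace I x →L[ℝ] ℝ}
    (h : ∀ X Z : Π x : M, TangentSpace I x, MDiffAt (T% X) x → MDiffAt (T% Z) x →
     B (X x) (Z x) = inner ℝ (A (X x)) (Z x)) : sharpHom B = A := by
  ext u
  refine ext_inner_right ℝ fun v ↦ ?_
  have := h (extend E u) (extend E v) (mdifferentiableAt_extend ..) (mdifferentiableAt_extend ..)
  simp at this
  rw [inner_sharpHom, this]

variable (I M) in
/-- The Levi-Civita connection `D`; `leviCivita I M Y x u` is the value of `D_u Y` at `x`. -/
def leviCivita : CovariantDerivative I E (TangentSpace I : M → Type _) where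
  toFun Y x := sharpHom (leviCivitaForm Y x)
  isCovariantDerivativeOnUniv :=
   { add {Y Y' x} hY hY' _ := by
      refine eq_sharpHom fun X Z hX hZ ↦ ?_
      rw [leviCivitaForm_apply hX (mdifferentiableAt_add_section hY hY') hZ]
      simp [inner_add_left, inner_sharpHom, leviCivitaForm_apply hX hY hZ,
        leviCivitaForm_apply hX hY' hZ]
      simp only [koszul, metricFun_comm X, metricFun_add]
      rw [mvfderiv_add (mdiff_metricFun hY hZ) (mdiff_metricFun hY' hZ),
        mvfderiv_add (mdiff_metricFun hY hX) (mdiff_metricFun hY' hX),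
        mlieBracket_add_left hY hY', mlieBracket_add_right hY hY']
      simp [inner_add_left, inner_add_right]
      ring
     leibniz {Y f x} hY hf _ := by
      refine eq_sharpHom fun X Z hX hZ ↦ ?_
      simp [inner_add_left, inner_smul_left, inner_sharpHom, leviCivitaForm_apply hX hY hZ,
        leviCivitaForm_apply hX (hf.smul_section hY) hZ]
      simp only [koszul, metricFun_comm X, metricFun_smul]
      rw [mvfderiv_mul hf (mdiff_metricFun hY hZ), mvfderiv_mul hf (mdiff_metricFun hY hX),
        mlieBracket_smul_left hf hY, mlieBracket_smul_right hf hY]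
      simp [inner_add_left, inner_smul_left, inner_smul_right, metricFun, real_inner_comm]
      ring }

theorem inner_leviCivita {X Y Z : Π x : M, TangentSpace I x} {x : M} (hX : MDiffAt (T% X) x)
    (hY : MDiffAt (T% Y) x) (hZ : MDiffAt (T% Z) x) :
    inner ℝ (leviCivita I M Y x (X x)) (Z x) = koszul X Y Z x :=
  (inner_sharpHom ..).trans (leviCivitaForm_apply hX hY hZ)

/-- The Levi-Civita connection is torsion free. -/
theorem leviCivita_torsion : (leviCivita I M).torsion = 0 := by
  rw [CovariantDerivative.torsion_eq_zero_iff]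
  intro X Y x hX hY
  refine ext_inner_right ℝ fun v ↦ ?_
  have hv : MDiffAt (T% (extend E v)) x := mdifferentiableAt_extend ..
  have h1 := inner_leviCivita hX hY hv
  have h2 := inner_leviCivita hY hX hv
  simp only [extend_apply_self] at h1 h2
  rw [inner_sub_left, h1, h2]
  have h3 : mlieBracket I Y X x = - mlieBracket I X Y x := mlieBracket_swap_apply
  have h4 : mlieBracket I (extend E v) X x = - mlieBracket I X (extend E v) x :=
    mlieBracket_swap_apply
  have h5 : mlieBracket I (extend E v) Y x = - mlieBracket I Y (extend E v) x :=
    mlieBracket_swap_apply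
  simp only [koszul, metricFun_comm Y X, metricFun_comm (extend E v), h3, h4, h5, inner_neg_left,
    extend_apply_self]
  ring

/-- The Levi-Civita connection is compatible with the metric. -/
theorem leviCivita_metric {X Y Z : Π x : M, TangentSpace I x} {x : M} (hX : MDiffAt (T% X) x)
    (hY : MDiffAt (T% Y) x) (hZ : MDiffAt (T% Z) x) :
    d% (metricFun Y Z) x (X x) = inner ℝ (leviCivita I M Y x (X x)) (Z x) +
      inner ℝ (Y x) (leviCivita I M Z x (X x)) := by
  rw [real_inner_comm _ (Y x), inner_leviCivita hX hY hZ, inner_leviCivita hX hZ hY]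
  have h1 : mlieBracket I X Y x = - mlieBracket I Y X x := mlieBracket_swap_apply
  have h2 : mlieBracket I X Z x = - mlieBracket I Z X x := mlieBracket_swap_apply
  have h3 : mlieBracket I Y Z x = - mlieBracket I Z Y x := mlieBracket_swap_apply
  simp only [koszul, metricFun_comm Z, metricFun_comm Y X, h1, h2, h3, inner_neg_left]
  ring

/-- The Riemann curvature tensor `R(u,v)w = D_U D_V W - D_V D_U W - D_[U,V] W` at `x`, computed with
the extensions of `u`, `v`, `w` to vector fields, smooth near `x`, that have constant coefficients in
the preferred trivialization at `x`. -/
def curvature (x : M) (u v w : TangentSpace I x) : TangentSpace I x :=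
  let D := leviCivita I M
  let U : Π y : M, TangentSpace I y := extend E u
  let V : Π y : M, TangentSpace I y := extend E v
  let W : Π y : M, TangentSpace I y := extend E w
  D (fun y ↦ D W y (V y)) x u - D (fun y ↦ D W y (U y)) x v - D W x (mlieBracket I U V x)

/-- The Ricci tensor `Ric(v,w)`, the trace of `u ↦ R(u,v)w`. -/
def ricci (x : M) (v w : TangentSpace I x) : ℝ :=
  ∑ i, inner ℝ (curvature x (stdOrthonormalBasis ℝ (TangentSpace I x) i) v w)
    (stdOrthonormalBasis ℝ (TangentSpace I x) i)

variable (I) in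
/-- The scalar curvature, the metric trace of the Ricci tensor. -/
def scalarCurvature (x : M) : ℝ :=
  ∑ i, ricci x (stdOrthonormalBasis ℝ (TangentSpace I x) i)
    (stdOrthonormalBasis ℝ (TangentSpace I x) i)

variable (I M) in
/-- The metric is Einstein: the Ricci tensor is a constant multiple of the metric. -/
def IsEinstein : Prop :=
  ∃ c : ℝ, ∀ (x : M) (u v : TangentSpace I x), ricci x u v = c * inner ℝ u v

variable (I M) in
/-- The space of Killing fields: the smooth vector fields `K` for which `u ↦ D_u K` is skew at every
point. -/
def killingFields : Submodule ℝ Cₛ^∞⟮I; E, (TangentSpace I : M → Type _)⟯ where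
  carrier := {K | ∀ (x : M) (u v : TangentSpace I x),
    inner ℝ (leviCivita I M K x u) v + inner ℝ u (leviCivita I M K x v) = 0}
  zero_mem' := by
    intro x u v
    have : leviCivita I M (0 : Π y : M, TangentSpace I y) = 0 := CovariantDerivative.zero _
    simp [this]
  add_mem' {K K'} hK hK' := by
    intro x u v
    have : leviCivita I M ((K : Π y : M, TangentSpace I y) + K') x =
        leviCivita I M K x + leviCivita I M K' x :=
      (leviCivita I M).isCovariantDerivativeOnUniv.add
        (K.contMDiff.mdifferentiable (by simp) x) (K'.contMDiff.mdifferentiable (by simp) x)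
    have h1 := hK x u v
    have h2 := hK' x u v
    simp only [ContMDiffSection.coe_add, this, add_apply, inner_add_left,
      inner_add_right]
    linear_combination h1 + h2
  smul_mem' c K hK := by
    intro x u v
    have : leviCivita I M (c • (K : Π y : M, TangentSpace I y)) x = c • leviCivita I M K x :=
      (leviCivita I M).isCovariantDerivativeOnUniv.smul_const c
        (K.contMDiff.mdifferentiable (by simp) x)
    have h1 := hK x u v
    simp only [ContMDiffSection.coe_smul, this, smul_apply, inner_smul_left,
      inner_smul_right]
    simp
    linear_combination c * h1

/-- The covariant derivative of an endomorphism field: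
`(D_u Ψ)(v) = D_u (Ψ V) - Ψ (D_u V)`, for `V` the extension of `v`. -/
def covDerivEnd (Ψ : Π x : M, TangentSpace I x →L[ℝ] TangentSpace I x) (x : M)
    (u v : TangentSpace I x) : TangentSpace I x :=
  leviCivita I M (fun y ↦ Ψ y (extend E v y)) x u - Ψ x (leviCivita I M (extend E v) x u)
end LC

section LinearAlgebra
variable {V : Type*} [NormedAddCommGroup V] [InnerProductSpace ℝ V] [FiniteDimensional ℝ V]

/-- The vector dual to a linear form. -/
def sharp (γ : V →L[ℝ] ℝ) : V :=
  ∑ i, γ (stdOrthonormalBasis ℝ V i) • stdOrthonormalBasis ℝ V i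

/-- The skew endomorphism `v ↦ γ(v) u - g(u, v) ♯γ`. -/
def wedge (γ : V →L[ℝ] ℝ) (u v : V) : V := γ v • u - (inner ℝ u v : ℝ) • sharp γ

theorem wedge_add (γ γ' : V →L[ℝ] ℝ) (u v : V) :
    wedge (γ + γ') u v = wedge γ u v + wedge γ' u v := by
  simp only [wedge, sharp, add_apply, add_smul, Finset.sum_add_distrib, smul_add]
  abel

theorem wedge_smul (c : ℝ) (γ : V →L[ℝ] ℝ) (u v : V) :
    wedge (c • γ) u v = c • wedge γ u v := by
  simp only [wedge, sharp, smul_apply, smul_eq_mul, mul_smul, ← Finset.smul_sum, smul_sub]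
  rw [smul_comm c (inner ℝ u v : ℝ)]

variable [Fact (finrank ℝ V = 4)]

/-- The Hodge star on skew endomorphisms of an oriented Euclidean 4-space. With `α(u,v) = ⟨A u, v⟩`,
`⟨(⋆A) u, v⟩ = (⋆α)(u,v) = 1/2 ∑ i, ∑ j, α(e i, e j) vol(e i, e j, u, v)`; for an oriented orthonormal
basis this sends `e⁰ ∧ e¹` to `e² ∧ e³`. For linear `A` it does not depend on the orthonormal basis. -/
def hodgeStar (o : Orientation ℝ V (Fin 4)) (A : V → V) (u : V) : V :=
  let e := stdOrthonormalBasis ℝ V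
  (2⁻¹ : ℝ) • ∑ i, ∑ j, ∑ k, (inner ℝ (A (e i)) (e j) * o.volumeForm ![e i, e j, u, e k]) • e k

/-- The antiselfdual part `A⁻ = (A - ⋆A) / 2` of a skew endomorphism `A`. -/
def asdPart (o : Orientation ℝ V (Fin 4)) (A : V → V) (u : V) : V :=
  (2⁻¹ : ℝ) • (A u - hodgeStar o A u)
theorem hodgeStar_add (o : Orientation ℝ V (Fin 4)) (A B : V → V) (u : V) :
    hodgeStar o (A + B) u = hodgeStar o A u + hodgeStar o B u := by
  simp only [hodgeStar, Pi.add_apply, inner_add_left, add_mul, add_smul, Finset.sum_add_distrib,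
    smul_add]

theorem hodgeStar_smul (o : Orientation ℝ V (Fin 4)) (c : ℝ) (A : V → V) (u : V) :
    hodgeStar o (c • A) u = c • hodgeStar o A u := by
  simp only [hodgeStar, Pi.smul_apply, real_inner_smul_left, mul_assoc, mul_smul c,
    ← Finset.smul_sum]
  rw [smul_comm c]

theorem asdPart_add (o : Orientation ℝ V (Fin 4)) (A B : V → V) (u : V) :
    asdPart o (A + B) u = asdPart o A u + asdPart o B u := by
  simp only [asdPart, hodgeStar_add, Pi.add_apply]
  module

theorem asdPart_smul (o : Orientation ℝ V (Fin 4)) (c : ℝ) (A : V → V) (u : V) :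
    asdPart o (c • A) u = c • asdPart o A u := by
  simp only [asdPart, hodgeStar_smul, Pi.smul_apply]
  module

end LinearAlgebra

section Four

variable (M : Type*) [TopologicalSpace M] [ChartedSpace (EuclideanSpace ℝ (Fin 4)) M] [IsManifold (𝓡 4) ∞ M]

instance (x : M) : Fact (finrank ℝ (TangentSpace (𝓡 4) x) = 4) :=
  ⟨(finrank_euclideanSpace_fin (𝕜 := ℝ) (n := 4) :)⟩

/-- An orientation of a 4-manifold: an orientation of each tangent space which is locally constant
in the trivializations of the tangent bundle. -/
structure ManifoldOrientation where
  toFun (x : M) : Orientation ℝ (TangentSpace (𝓡 4) x) (Fin 4)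
  locallyConstant (x : M) : ∀ᶠ y in 𝓝 x,
    ∀ hy : y ∈ (trivializationAt (EuclideanSpace ℝ (Fin 4)) (TangentSpace (𝓡 4)) x).baseSet,
      Orientation.map (Fin 4)
        ((trivializationAt (EuclideanSpace ℝ (Fin 4)) (TangentSpace (𝓡 4)) x).linearEquivAt ℝ y hy) (toFun y) =
      Orientation.map (Fin 4)
        ((trivializationAt (EuclideanSpace ℝ (Fin 4)) (TangentSpace (𝓡 4)) x).linearEquivAt ℝ x
          (mem_baseSet_trivializationAt (EuclideanSpace ℝ (Fin 4)) (TangentSpace (𝓡 4)) x)) (toFun x)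

variable {M} [RiemannianBundle (fun x : M ↦ TangentSpace (𝓡 4) x)]
  [IsContMDiffRiemannianBundle (𝓡 4) ∞ (EuclideanSpace ℝ (Fin 4)) (fun x : M ↦ TangentSpace (𝓡 4) x)]

/-- The Schouten tensor in dimension four, `P = (Ric - (scal / 6) g) / 2`. -/
def schouten (x : M) (u v : TangentSpace (𝓡 4) x) : ℝ :=
  2⁻¹ * (ricci x u v - scalarCurvature (𝓡 4) x / 6 * inner ℝ u v)

/-- The Schouten tensor as an endomorphism. -/
def schoutenSharp (x : M) (u : TangentSpace (𝓡 4) x) : TangentSpace (𝓡 4) x :=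
  ∑ i, schouten x u (stdOrthonormalBasis ℝ (TangentSpace (𝓡 4) x) i) •
    stdOrthonormalBasis ℝ (TangentSpace (𝓡 4) x) i

/-- The Weyl tensor in dimension four, as an endomorphism valued 2-form `(u, v) ↦ W(u, v)`. -/
def weyl (x : M) (u v w : TangentSpace (𝓡 4) x) : TangentSpace (𝓡 4) x :=
  curvature x u v w - (schouten x v w • u - schouten x u w • v
    + (inner ℝ v w : ℝ) • schoutenSharp x u - (inner ℝ u w : ℝ) • schoutenSharp x v)

/-- The metric is selfdual: the antiselfdual part `W⁻` of the Weyl tensor vanishes. -/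
def IsSelfdual (o : ManifoldOrientation M) : Prop :=
  ∀ (x : M) (u v : TangentSpace (𝓡 4) x), asdPart (o.toFun x) (weyl x u v) = 0

/-- Smooth sections of the bundle `End(TM)`. -/
abbrev EndField (M : Type*) [TopologicalSpace M] [ChartedSpace (EuclideanSpace ℝ (Fin 4)) M]
    [IsManifold (𝓡 4) ∞ M] :=
  Cₛ^∞⟮𝓡 4; EuclideanSpace ℝ (Fin 4) →L[ℝ] EuclideanSpace ℝ (Fin 4),
    fun x : M ↦ TangentSpace (𝓡 4) x →L[ℝ] TangentSpace (𝓡 4) x⟯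

/-- Smooth 1-forms. -/
abbrev OneForm (M : Type*) [TopologicalSpace M] [ChartedSpace (EuclideanSpace ℝ (Fin 4)) M]
    [IsManifold (𝓡 4) ∞ M] :=
  Cₛ^∞⟮𝓡 4; EuclideanSpace ℝ (Fin 4) →L[ℝ] ℝ, fun x : M ↦ TangentSpace (𝓡 4) x →L[ℝ] ℝ⟯

/-- An antiselfdual (skew) endomorphism field `Ψ` is a twistor if there is a 1-form `γ` such that
`D_u Ψ` is the antiselfdual part of `v ↦ γ(v) u - g(u, v) ♯γ` for all tangent vectors `u`. -/
structure IsTwistor (o : ManifoldOrientation M) (Ψ : EndField M) : Prop where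
  skew (x : M) (u v : TangentSpace (𝓡 4) x) : inner ℝ (Ψ x u) v + inner ℝ u (Ψ x v) = 0
  antiselfdual (x : M) (u : TangentSpace (𝓡 4) x) : hodgeStar (o.toFun x) (Ψ x) u = - Ψ x u
  twistor_equation : ∃ γ : OneForm M, ∀ (x : M) (u v : TangentSpace (𝓡 4) x),
    covDerivEnd Ψ x u v = asdPart (o.toFun x) (wedge (γ x) u) v

theorem mdiff_endField_apply (Ψ : EndField M) {x : M} (v : TangentSpace (𝓡 4) x) :
    MDifferentiableAt (𝓡 4) ((𝓡 4).prod 𝓘(ℝ, EuclideanSpace ℝ (Fin 4)))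
      (fun y : M ↦ (⟨y, Ψ y (extend (EuclideanSpace ℝ (Fin 4)) v y)⟩ :
        TotalSpace (EuclideanSpace ℝ (Fin 4)) (TangentSpace (𝓡 4) : M → Type _))) x :=
  MDifferentiableAt.clm_bundle_apply
    (F₁ := EuclideanSpace ℝ (Fin 4)) (F₂ := EuclideanSpace ℝ (Fin 4))
    (E₁ := fun x : M ↦ TangentSpace (𝓡 4) x) (E₂ := fun x : M ↦ TangentSpace (𝓡 4) x)
    (b := fun y ↦ y)
    (Ψ.contMDiff.mdifferentiable (by simp) x) (mdifferentiableAt_extend ..)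

theorem covDerivEnd_add (Ψ Φ : EndField M) (x : M) (u v : TangentSpace (𝓡 4) x) :
    covDerivEnd (Ψ + Φ : EndField M) x u v = covDerivEnd Ψ x u v + covDerivEnd Φ x u v := by
  have h := (leviCivita (𝓡 4) M).isCovariantDerivativeOnUniv.add
    (mdiff_endField_apply Ψ v) (mdiff_endField_apply Φ v)
  have h' := congrArg (fun A ↦ A u) h
  simp only [add_apply] at h'
  have e : (fun y ↦ (Ψ + Φ : EndField M) y (extend (EuclideanSpace ℝ (Fin 4)) v y)) =
    (fun y ↦ Ψ y (extend (EuclideanSpace ℝ (Fin 4)) v y)) +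
      (fun y ↦ Φ y (extend (EuclideanSpace ℝ (Fin 4)) v y)) := rfl
  simp only [covDerivEnd]
  rw [e, h']
  simp only [ContMDiffSection.coe_add, Pi.add_apply, add_apply]
  abel

theorem covDerivEnd_smul (c : ℝ) (Ψ : EndField M) (x : M) (u v : TangentSpace (𝓡 4) x) :
    covDerivEnd (c • Ψ : EndField M) x u v = c • covDerivEnd Ψ x u v := by
  have h := (leviCivita (𝓡 4) M).isCovariantDerivativeOnUniv.smul_const c
    (mdiff_endField_apply Ψ v)
  have h' := congrArg (fun A ↦ A u) h
  simp only [smul_apply] at h'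
  have e : (fun y ↦ (c • Ψ : EndField M) y (extend (EuclideanSpace ℝ (Fin 4)) v y)) =
    c • (fun y ↦ Ψ y (extend (EuclideanSpace ℝ (Fin 4)) v y)) := rfl
  simp only [covDerivEnd]
  rw [e, h']
  simp only [ContMDiffSection.coe_smul, Pi.smul_apply, smul_apply, smul_sub]

/-- The space of twistors. -/
def twistors (o : ManifoldOrientation M) : Submodule ℝ (EndField M) where
  carrier := {Ψ | IsTwistor o Ψ}
  zero_mem' := by
    refine ⟨fun x u v ↦ by simp, fun x u ↦ by simp [hodgeStar], 0, fun x u v ↦ ?_⟩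
    have := covDerivEnd_smul 0 (0 : EndField M) x u v
    have e : (0 : ℝ) • (0 : EndField M) = 0 := ContMDiffSection.ext fun x ↦
      smul_zero (A := TangentSpace (𝓡 4) x →L[ℝ] TangentSpace (𝓡 4) x) (0 : ℝ)
    rw [zero_smul, e] at this
    rw [this]
    simp [asdPart, hodgeStar, wedge, sharp]
  add_mem' := by
    rintro Ψ Φ ⟨hs, ha, γ, hγ⟩ ⟨hs', ha', γ', hγ'⟩
    refine ⟨fun x u v ↦ ?_, fun x u ↦ ?_, γ + γ', fun x u v ↦ ?_⟩
    · have h1 := hs x u v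
      have h2 := hs' x u v
      simp only [ContMDiffSection.coe_add, Pi.add_apply, add_apply, inner_add_left,
        inner_add_right]
      linear_combination h1 + h2
    · have h1 := ha x u
      have h2 := ha' x u
      have : hodgeStar (o.toFun x) ((Ψ + Φ : EndField M) x) u =
          hodgeStar (o.toFun x) (Ψ x) u + hodgeStar (o.toFun x) (Φ x) u :=
        hodgeStar_add _ _ _ _
      rw [this, h1, h2]
      simp only [ContMDiffSection.coe_add, Pi.add_apply, add_apply, neg_add]
    · rw [covDerivEnd_add, hγ, hγ', ← asdPart_add]
      congr 1
      ext w
      exact (wedge_add _ _ _ _).symm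
  smul_mem' := by
    rintro c Ψ ⟨hs, ha, γ, hγ⟩
    refine ⟨fun x u v ↦ ?_, fun x u ↦ ?_, c • γ, fun x u v ↦ ?_⟩
    · have h1 := hs x u v
      simp only [ContMDiffSection.coe_smul, Pi.smul_apply, smul_apply, inner_smul_left,
        inner_smul_right]
      simp
      linear_combination c * h1
    · have h1 := ha x u
      have : hodgeStar (o.toFun x) ((c • Ψ : EndField M) x) u =
          c • hodgeStar (o.toFun x) (Ψ x) u :=
        hodgeStar_smul _ _ _ _
      rw [this, h1]
      simp only [ContMDiffSection.coe_smul, Pi.smul_apply, smul_apply, smul_neg]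
    · rw [covDerivEnd_smul, hγ, ← asdPart_smul]
      congr 1
      ext w
      exact (wedge_smul _ _ _ _).symm

end Four
end SelfdualEinstein
end

/-!
On a selfdual Einstein 4-manifold with `Ric = c g`, `c ≠ 0`, Killing fields correspond to twistors
because the antiselfdual part of the curvature is that of a space form: the Weyl tensor is
`R(u, v) - (c / 3) v ∧ u`, hence `R(u, v)⁻ = (c / 3) (v ∧ u)⁻` (`asdPart_curvature`). Here `G ∧ u`
is the skew endomorphism `v ↦ g(G, v) u - g(u, v) G`, that is, `♯γ ∧ u = γ ∆ u`.

*From Killing fields to twistors.* A Killing field `K` satisfies `D²_{u,v} K = R(u, K) v`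
(`covDerivEnd_leviCivita_of_killing`). The Hodge star is parallel (`covDerivEnd_asdField`), so that
`D_u (DK)⁻ = R(u, K)⁻ = (c / 3) (K ∧ u)⁻`, which is the twistor equation with `♯γ = (c / 3) K`
(`covDerivEnd_asdDeriv`). It also shows that `K` vanishes if `(DK)⁻` does, since `c ≠ 0` and
`G ↦ (u ↦ (G ∧ u)⁻)` is injective (`eq_zero_of_asdPart_wedgeHom_eq_zero`).

*From twistors to Killing fields.* Let `D_u Ψ = (G ∧ u)⁻` with `G = ♯γ`. Differentiating once more
and antisymmetrizing gives, by the Ricci identity (`curvature_commutator`),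
`(D_u G ∧ v - D_v G ∧ u)⁻ = [R(u, v), Ψ]` (`asdPart_wedgeHom_sub_eq_curvature`). As selfdual
endomorphisms commute with `Ψ`, only `R(u, v)⁻` enters on the right, and this is known. The result
is a system of linear equations for the endomorphism `DG` of a tangent space, which says that `DG`
is skew with `(DG)⁻ = (c / 3) Ψ` (`isSkew_and_asdPart_eq_of_commutator`). So `K = (3 / c) G` is a
Killing field with `(DK)⁻ = Ψ`.

The connection and the curvature are given by pointwise formulas, so their differential geometry is
established first: the Levi-Civita derivative of a smooth field is smooth
(`contMDiffAt_leviCivita`), and the curvature is tensorial (`curvatureField_eq`), skew, and has the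
Bianchi and pair symmetries. Smoothness of antiselfdual parts and the parallelism of the Hodge star
are checked in smooth oriented orthonormal frames (`exists_oriented_orthonormal_frame`), where
`A ↦ A⁻` acts on matrix entries with constant coefficients. For skew `A` the derivative
`D_u A` is skew, and this is what makes it tensorial (`leviCivita_end_apply`).
-/

noncomputable section
namespace SelfdualEinstein

set_option linter.unusedSectionVars false

/-! ### Smooth vector fields and smoothness of the Levi-Civita connection -/

section SmoothFields
variable {E : Type*} [NormedAddCommGroup E] [NormedSpace ℝ E] [FiniteDimensional ℝ E]
  {H : Type*} [TopologicalSpace H] {I : ModelWithCorners ℝ E H}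
  {M : Type*} [TopologicalSpace M] [ChartedSpace H M] [IsManifold I ∞ M]

theorem eventually_mdiffAt {X : Π x : M, TangentSpace I x} {x : M} (hX : CMDiffAt ∞ (T% X) x) :
    ∀ᶠ y in 𝓝 x, MDiffAt (T% X) y := by
  have : CMDiffAt 1 (T% X) x := hX.of_le (by simp)
  exact ((contMDiffAt_iff_contMDiffAt_nhds (by simp)).mp this).mono
    fun y hy ↦ hy.mdifferentiableAt one_ne_zero

theorem eventually_mdiffAt_fun {f : M → ℝ} {x : M} (hf : CMDiffAt ∞ f x) :
    ∀ᶠ y in 𝓝 x, MDiffAt f y := by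
  have : CMDiffAt 1 f x := hf.of_le (by simp)
  exact ((contMDiffAt_iff_contMDiffAt_nhds (by simp)).mp this).mono
    fun y hy ↦ hy.mdifferentiableAt one_ne_zero

theorem contMDiffAt_mlieBracket {X Y : Π x : M, TangentSpace I x} {x : M}
    (hX : CMDiffAt ∞ (T% X) x) (hY : CMDiffAt ∞ (T% Y) x) :
    CMDiffAt ∞ (T% (mlieBracket I X Y)) x := by
  have : CompleteSpace E := FiniteDimensional.complete ℝ E
  have : IsManifold I ((⊤ : ℕ∞) + 1) M := by simpa
  have : IsManifold I (minSmoothness ℝ 2) M := by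
    simp only [minSmoothness_of_isRCLikeNormedField]
    exact IsManifold.of_le (n := ∞) (by norm_cast)
  exact ContMDiffAt.mlieBracket_vectorField (m := ⊤) (n := ⊤) hX hY (by simp)

theorem jacobi_mlieBracket {X Y Z : Π x : M, TangentSpace I x} {x : M}
    (hX : CMDiffAt ∞ (T% X) x) (hY : CMDiffAt ∞ (T% Y) x) (hZ : CMDiffAt ∞ (T% Z) x) :
    mlieBracket I X (mlieBracket I Y Z) x =
      mlieBracket I (mlieBracket I X Y) Z x + mlieBracket I Y (mlieBracket I X Z) x := by
  have : CompleteSpace E := FiniteDimensional.complete ℝ E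
  have : IsManifold I (minSmoothness ℝ 3) M := by
    simp only [minSmoothness_of_isRCLikeNormedField]
    exact IsManifold.of_le (n := ∞) (by norm_cast)
  have h2 : minSmoothness ℝ 2 ≤ ∞ := by
    simp only [minSmoothness_of_isRCLikeNormedField]
    norm_cast
  exact leibniz_identity_mlieBracket_apply (hX.of_le h2) (hY.of_le h2) (hZ.of_le h2)

variable [RiemannianBundle (fun x : M ↦ TangentSpace I x)]
  [IsContMDiffRiemannianBundle I ∞ E (fun x : M ↦ TangentSpace I x)]

theorem contMDiffAt_metricFun {X Y : Π x : M, TangentSpace I x} {x : M}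
    (hX : CMDiffAt ∞ (T% X) x) (hY : CMDiffAt ∞ (T% Y) x) : CMDiffAt ∞ (metricFun X Y) x :=
  ContMDiffAt.inner_bundle (IB := I) (F := E) (E := fun x : M ↦ TangentSpace I x) hX hY

/-- Here `df(X)` is recovered from the smooth field `[X, f W] - f [X, W] = df(X) W`, for a field `W`
that does not vanish near the point. -/
theorem contMDiffAt_mvfderiv {f : M → ℝ} {X : Π x : M, TangentSpace I x} {x : M}
    (hf : CMDiffAt ∞ f x) (hX : CMDiffAt ∞ (T% X) x) :
    CMDiffAt ∞ (fun y ↦ d% f y (X y)) x := by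
  rcases subsingleton_or_nontrivial E with hE | hE
  · have (y : M) : X y = 0 := Subsingleton.elim (α := E) _ _
    simp only [this, map_zero]
    exact contMDiffAt_const
  obtain ⟨w, hw⟩ : ∃ w : TangentSpace I x, w ≠ 0 := exists_ne (α := E) 0
  set W : Π y : M, TangentSpace I y := extend E w
  have hW : CMDiffAt ∞ (T% W) x := contMDiffAt_extend ..
  have hN : CMDiffAt ∞ (metricFun W W) x := contMDiffAt_metricFun hW hW
  have hN0 : metricFun W W x ≠ 0 := by simp [metricFun, W, hw]
  have h1 := contMDiffAt_metricFun (contMDiffAt_mlieBracket hX (hf.smul_section hW)) hW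
  have h2 := contMDiffAt_metricFun (contMDiffAt_mlieBracket hX hW) hW
  have h3 := (h1.sub (hf.mul h2)).div₀ hN hN0
  refine h3.congr_of_eventuallyEq ?_
  filter_upwards [eventually_mdiffAt_fun hf, eventually_mdiffAt hW,
    hN.continuousAt.eventually_ne hN0] with y hfy hWy hNy
  have := mlieBracket_smul_right (V := X) hfy hWy
  simp only [Pi.div_apply, Pi.mul_apply]
  rw [eq_div_iff hNy]
  simp only [metricFun, this, inner_add_left, inner_smul_left]
  simp

/-- The Jacobi identity for `X`, `Y` and `f W` contains `[X, Y] f = X (Y f) - Y (X f)` as the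
coefficient of `W`. -/
theorem mvfderiv_mlieBracket {f : M → ℝ} {X Y : Π x : M, TangentSpace I x} {x : M}
    (hf : CMDiffAt ∞ f x) (hX : CMDiffAt ∞ (T% X) x) (hY : CMDiffAt ∞ (T% Y) x) :
    d% f x (mlieBracket I X Y x) =
      d% (fun y ↦ d% f y (Y y)) x (X x) - d% (fun y ↦ d% f y (X y)) x (Y x) := by
  rcases subsingleton_or_nontrivial E with hE | hE
  · have (y : M) (v : TangentSpace I y) : v = 0 := Subsingleton.elim (α := E) _ _
    simp [this _ (X x), this _ (Y x), this _ (mlieBracket I X Y x)]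
  obtain ⟨w, hw⟩ : ∃ w : TangentSpace I x, w ≠ 0 := exists_ne (α := E) 0
  set W : Π y : M, TangentSpace I y := extend E w
  have hW : CMDiffAt ∞ (T% W) x := contMDiffAt_extend ..
  have key : ∀ {X Y : Π x : M, TangentSpace I x}, CMDiffAt ∞ (T% X) x → CMDiffAt ∞ (T% Y) x →
      mlieBracket I X (mlieBracket I Y (f • W)) x =
        d% (fun y ↦ d% f y (Y y)) x (X x) • w + d% f x (Y x) • mlieBracket I X W x
        + d% f x (X x) • mlieBracket I Y W x + f x • mlieBracket I X (mlieBracket I Y W) x := by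
    intro X Y hX hY
    have hYf := contMDiffAt_mvfderiv hf hY
    have hYW := contMDiffAt_mlieBracket hY hW
    have e : mlieBracket I Y (f • W) =ᶠ[𝓝 x]
        (fun y ↦ d% f y (Y y)) • W + f • mlieBracket I Y W := by
      filter_upwards [eventually_mdiffAt_fun hf, eventually_mdiffAt hW] with y hfy hWy
      rw [mlieBracket_smul_right (V := Y) hfy hWy]
      rfl
    rw [(Filter.EventuallyEq.refl _ X).mlieBracket_vectorField_eq e,
      mlieBracket_add_right ((hYf.smul_section hW).mdifferentiableAt (by simp))
        ((hf.smul_section hYW).mdifferentiableAt (by simp)),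
      mlieBracket_smul_right (hYf.mdifferentiableAt (by simp)) (hW.mdifferentiableAt (by simp)),
      mlieBracket_smul_right (hf.mdifferentiableAt (by simp)) (hYW.mdifferentiableAt (by simp))]
    simp only [W, extend_apply_self]
    abel
  have h1 := jacobi_mlieBracket hX hY (hf.smul_section hW)
  have h2 := jacobi_mlieBracket hX hY hW
  rw [key hX hY, key hY hX, mlieBracket_smul_right (hf.mdifferentiableAt (by simp))
    (hW.mdifferentiableAt (by simp)), h2] at h1
  simp only [W, extend_apply_self] at h1
  have h3 : (d% f x (mlieBracket I X Y x) -
      (d% (fun y ↦ d% f y (Y y)) x (X x) - d% (fun y ↦ d% f y (X y)) x (Y x))) • w = 0 := by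
    simp only [smul_add] at h1
    rw [sub_smul, sub_smul]
    rw [← sub_eq_zero] at h1
    rw [← neg_eq_zero, ← h1]
    abel
  have := (smul_eq_zero.mp h3).resolve_right hw
  linarith

theorem contMDiffAt_gramSchmidt {ι : Type*} [LinearOrder ι] [LocallyFiniteOrderBot ι]
    [WellFoundedLT ι] {b : ι → Π y : M, TangentSpace I y} {x : M}
    (hb : ∀ i, CMDiffAt ∞ (T% (b i)) x) (hli : LinearIndependent ℝ fun i ↦ b i x) (i : ι) :
    CMDiffAt ∞ (T% fun y ↦ InnerProductSpace.gramSchmidt ℝ (fun j ↦ b j y) i) x := by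
  induction i using WellFoundedLT.induction with
  | ind i ih =>
  have e : (fun y ↦ InnerProductSpace.gramSchmidt ℝ (fun j ↦ b j y) i) =
      b i - fun y ↦ ∑ j ∈ Finset.Iio i,
        (metricFun (fun y ↦ InnerProductSpace.gramSchmidt ℝ (fun j ↦ b j y) j) (b i) /
          metricFun (fun y ↦ InnerProductSpace.gramSchmidt ℝ (fun j ↦ b j y) j)
          (fun y ↦ InnerProductSpace.gramSchmidt ℝ (fun j ↦ b j y) j)) y •
          InnerProductSpace.gramSchmidt ℝ (fun j ↦ b j y) j := by
    ext y
    have := InnerProductSpace.gramSchmidt_def'' ℝ (fun j ↦ b j y) i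
    simp only [Pi.sub_apply, Pi.div_apply, metricFun, real_inner_self_eq_norm_sq]
    rw [eq_sub_iff_add_eq]
    exact this.symm
  suffices h : CMDiffAt ∞ (T% (b i - fun y ↦ ∑ j ∈ Finset.Iio i,
      (metricFun (fun y ↦ InnerProductSpace.gramSchmidt ℝ (fun j ↦ b j y) j) (b i) /
        metricFun (fun y ↦ InnerProductSpace.gramSchmidt ℝ (fun j ↦ b j y) j)
        (fun y ↦ InnerProductSpace.gramSchmidt ℝ (fun j ↦ b j y) j)) y •
        InnerProductSpace.gramSchmidt ℝ (fun j ↦ b j y) j)) x by rwa [← e] at h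
  refine (hb i).sub_section (ContMDiffAt.sum_section fun j hj ↦ ?_)
  have hj' := ih j (Finset.mem_Iio.mp hj)
  refine ContMDiffAt.smul_section (ContMDiffAt.div₀ (contMDiffAt_metricFun hj' (hb i))
    (contMDiffAt_metricFun hj' hj') ?_) hj'
  simp [metricFun, InnerProductSpace.gramSchmidt_ne_zero j hli]

theorem contMDiffAt_gramSchmidtNormed {ι : Type*} [LinearOrder ι] [LocallyFiniteOrderBot ι]
    [WellFoundedLT ι] {b : ι → Π y : M, TangentSpace I y} {x : M}
    (hb : ∀ i, CMDiffAt ∞ (T% (b i)) x) (hli : LinearIndependent ℝ fun i ↦ b i x) (i : ι) :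
    CMDiffAt ∞ (T% fun y ↦ InnerProductSpace.gramSchmidtNormed ℝ (fun j ↦ b j y) i) x := by
  have h := contMDiffAt_gramSchmidt hb hli i
  have hN := contMDiffAt_metricFun h h
  have h0 : metricFun (fun y ↦ InnerProductSpace.gramSchmidt ℝ (fun j ↦ b j y) i)
      (fun y ↦ InnerProductSpace.gramSchmidt ℝ (fun j ↦ b j y) i) x ≠ 0 := by
    simp [metricFun, InnerProductSpace.gramSchmidt_ne_zero i hli]
  have hs : CMDiffAt ∞ (fun y ↦ (Real.sqrt (metricFun
      (fun y ↦ InnerProductSpace.gramSchmidt ℝ (fun j ↦ b j y) i)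
      (fun y ↦ InnerProductSpace.gramSchmidt ℝ (fun j ↦ b j y) i) y))⁻¹) x := by
    have : ContDiffAt ℝ ∞ (fun t : ℝ ↦ (Real.sqrt t)⁻¹) (metricFun
      (fun y ↦ InnerProductSpace.gramSchmidt ℝ (fun j ↦ b j y) i)
      (fun y ↦ InnerProductSpace.gramSchmidt ℝ (fun j ↦ b j y) i) x) := by
      refine (Real.contDiffAt_sqrt h0).inv ?_
      rw [metricFun, ← norm_eq_sqrt_real_inner]
      simp [InnerProductSpace.gramSchmidt_ne_zero i hli]
    exact this.contMDiffAt.comp x hN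
  have e : (fun y ↦ InnerProductSpace.gramSchmidtNormed ℝ (fun j ↦ b j y) i) =
      (fun y ↦ (Real.sqrt (metricFun
      (fun y ↦ InnerProductSpace.gramSchmidt ℝ (fun j ↦ b j y) i)
      (fun y ↦ InnerProductSpace.gramSchmidt ℝ (fun j ↦ b j y) i) y))⁻¹) •
      (fun y ↦ InnerProductSpace.gramSchmidt ℝ (fun j ↦ b j y) i) := by
    ext y
    simp only [Pi.smul_apply', metricFun, ← norm_eq_sqrt_real_inner]
    rfl
  have := hs.smul_section h
  rwa [← e] at this

/-- The extensions of the vectors of a basis of `T_x M` form a basis at all points near `x`. -/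
theorem eventually_linearIndependent_extend {ι : Type*} {x : M} {b : ι → TangentSpace I x}
    (hb : LinearIndependent ℝ b) :
    ∀ᶠ y in 𝓝 x, LinearIndependent ℝ fun i ↦ (extend E (b i) y : TangentSpace I y) := by
  set t := trivializationAt E (TangentSpace I : M → Type _) x
  have hx : x ∈ t.baseSet := mem_baseSet_trivializationAt ..
  filter_upwards [t.open_baseSet.mem_nhds hx] with y hy
  have := (hb.map' (t.linearEquivAt ℝ x hx).toLinearMap (LinearEquiv.ker _)).map'
    (t.linearEquivAt ℝ y hy).symm.toLinearMap (LinearEquiv.ker _)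
  exact this

theorem exists_orthonormal_frame (x : M) :
    ∃ e : Fin (finrank ℝ E) → Π y : M, TangentSpace I y,
      (∀ i, CMDiffAt ∞ (T% (e i)) x) ∧ ∀ᶠ y in 𝓝 x, Orthonormal ℝ fun i ↦ e i y := by
  let b : Basis (Fin (finrank ℝ E)) ℝ (TangentSpace I x) := finBasis ℝ E
  have hli : LinearIndependent ℝ fun i ↦ (extend E (b i) x : TangentSpace I x) := by
    simpa using b.linearIndependent
  refine ⟨fun i y ↦ InnerProductSpace.gramSchmidtNormed ℝ (fun j ↦ extend E (b j) y) i,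
    fun i ↦ contMDiffAt_gramSchmidtNormed (b := fun j ↦ extend E (b j))
      (fun j ↦ contMDiffAt_extend ..) hli i, ?_⟩
  filter_upwards [eventually_linearIndependent_extend b.linearIndependent] with y hy
  exact InnerProductSpace.gramSchmidtNormed_orthonormal hy

theorem sum_inner_smul_of_orthonormal {y : M} {e : Fin (finrank ℝ E) → TangentSpace I y}
    (he : Orthonormal ℝ e) (v : TangentSpace I y) : ∑ i, (inner ℝ v (e i) : ℝ) • e i = v := by
  have hc : Fintype.card (Fin (finrank ℝ E)) = finrank ℝ (TangentSpace I y) := by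
    rw [Fintype.card_fin]; rfl
  let b := OrthonormalBasis.mk he
    (he.linearIndependent.span_eq_top_of_card_eq_finrank' hc).ge
  have := b.sum_repr' v
  simpa [b, real_inner_comm] using this

/-- A vector field is smooth when its scalar products with smooth fields are. -/
theorem contMDiffAt_of_metricFun {X : Π x : M, TangentSpace I x} {x : M}
    (h : ∀ Z : Π x : M, TangentSpace I x, CMDiffAt ∞ (T% Z) x → CMDiffAt ∞ (metricFun X Z) x) :
    CMDiffAt ∞ (T% X) x := by
  obtain ⟨e, he, ho⟩ := exists_orthonormal_frame (I := I) x
  have : CMDiffAt ∞ (T% fun y ↦ ∑ i, metricFun X (e i) y • e i y) x :=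
    ContMDiffAt.sum_section fun i _ ↦ (h (e i) (he i)).smul_section (he i)
  refine this.congr_of_eventuallyEq ?_
  filter_upwards [ho] with y hy
  have := sum_inner_smul_of_orthonormal hy (X y)
  simp only [metricFun]
  rw [this]

theorem contMDiffAt_koszul {X Y Z : Π x : M, TangentSpace I x} {x : M}
    (hX : CMDiffAt ∞ (T% X) x) (hY : CMDiffAt ∞ (T% Y) x) (hZ : CMDiffAt ∞ (T% Z) x) :
    CMDiffAt ∞ (koszul X Y Z) x := by
  have h1 := contMDiffAt_mvfderiv (contMDiffAt_metricFun hY hZ) hX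
  have h2 := contMDiffAt_mvfderiv (contMDiffAt_metricFun hZ hX) hY
  have h3 := contMDiffAt_mvfderiv (contMDiffAt_metricFun hX hY) hZ
  have h4 := contMDiffAt_metricFun (contMDiffAt_mlieBracket hX hY) hZ
  have h5 := contMDiffAt_metricFun (contMDiffAt_mlieBracket hY hZ) hX
  have h6 := contMDiffAt_metricFun (contMDiffAt_mlieBracket hZ hX) hY
  exact contMDiffAt_const.mul (((((h1.add h2).sub h3).add h4).sub h5).add h6)

/-- The Levi-Civita connection of a smooth metric is smooth. -/
theorem contMDiffAt_leviCivita {X Y : Π x : M, TangentSpace I x} {x : M}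
    (hX : CMDiffAt ∞ (T% X) x) (hY : CMDiffAt ∞ (T% Y) x) :
    CMDiffAt ∞ (T% fun y ↦ leviCivita I M Y y (X y)) x := by
  refine contMDiffAt_of_metricFun fun Z hZ ↦ (contMDiffAt_koszul hX hY hZ).congr_of_eventuallyEq ?_
  filter_upwards [eventually_mdiffAt hX, eventually_mdiffAt hY, eventually_mdiffAt hZ]
    with y hXy hYy hZy
  exact inner_leviCivita hXy hYy hZy

end SmoothFields

/-! ### Symmetries of the curvature tensor -/

section Curvature
variable {E : Type*} [NormedAddCommGroup E] [NormedSpace ℝ E] [FiniteDimensional ℝ E]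
  {H : Type*} [TopologicalSpace H] {I : ModelWithCorners ℝ E H}
  {M : Type*} [TopologicalSpace M] [ChartedSpace H M] [IsManifold I ∞ M]
  [RiemannianBundle (fun x : M ↦ TangentSpace I x)]
  [IsContMDiffRiemannianBundle I ∞ E (fun x : M ↦ TangentSpace I x)]

theorem leviCivita_congr {Y Y' : Π x : M, TangentSpace I x} {x : M} (hY : MDiffAt (T% Y) x)
    (hY' : MDiffAt (T% Y') x) (h : Y =ᶠ[𝓝 x] Y') : leviCivita I M Y x = leviCivita I M Y' x :=
  (leviCivita I M).isCovariantDerivativeOnUniv.congr_of_eventuallyEq hY hY' Filter.univ_mem h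

theorem leviCivita_add {Y Y' : Π x : M, TangentSpace I x} {x : M} (hY : MDiffAt (T% Y) x)
    (hY' : MDiffAt (T% Y') x) (u : TangentSpace I x) :
    leviCivita I M (Y + Y') x u = leviCivita I M Y x u + leviCivita I M Y' x u := by
  have := (leviCivita I M).isCovariantDerivativeOnUniv.add hY hY'
  exact congrArg (fun A ↦ A u) this

theorem leviCivita_const_smul {Y : Π x : M, TangentSpace I x} {x : M} (c : ℝ)
    (hY : MDiffAt (T% Y) x) (u : TangentSpace I x) :
    leviCivita I M (c • Y) x u = c • leviCivita I M Y x u := by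
  have := (leviCivita I M).isCovariantDerivativeOnUniv.smul_const c hY
  exact congrArg (fun A ↦ A u) this

theorem leviCivita_sub {Y Y' : Π x : M, TangentSpace I x} {x : M} (hY : MDiffAt (T% Y) x)
    (hY' : MDiffAt (T% Y') x) (u : TangentSpace I x) :
    leviCivita I M (Y - Y') x u = leviCivita I M Y x u - leviCivita I M Y' x u := by
  have h : (-1 : ℝ) • Y' = -Y' := by ext; simp
  have h' : MDiffAt (T% (-Y')) x := by
    rw [← h]
    exact mdifferentiableAt_const.smul_section hY'
  rw [sub_eq_add_neg, leviCivita_add hY h', ← h, leviCivita_const_smul _ hY']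
  module

theorem leviCivita_smul {Y : Π x : M, TangentSpace I x} {f : M → ℝ} {x : M}
    (hf : MDiffAt f x) (hY : MDiffAt (T% Y) x) (u : TangentSpace I x) :
    leviCivita I M (f • Y) x u = f x • leviCivita I M Y x u + d% f x u • Y x := by
  have := (leviCivita I M).isCovariantDerivativeOnUniv.leibniz hY hf
  exact congrArg (fun A ↦ A u) this

theorem leviCivita_sub_leviCivita {X Y : Π x : M, TangentSpace I x} {x : M}
    (hX : MDiffAt (T% X) x) (hY : MDiffAt (T% Y) x) :
    leviCivita I M Y x (X x) - leviCivita I M X x (Y x) = mlieBracket I X Y x :=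
  (CovariantDerivative.torsion_eq_zero_iff (leviCivita I M)).mp leviCivita_torsion hX hY

theorem mvfderiv_metricFun {Y Z : Π x : M, TangentSpace I x} {x : M}
    (hY : MDiffAt (T% Y) x) (hZ : MDiffAt (T% Z) x) (u : TangentSpace I x) :
    d% (metricFun Y Z) x u =
      inner ℝ (leviCivita I M Y x u) (Z x) + inner ℝ (Y x) (leviCivita I M Z x u) := by
  have := leviCivita_metric (X := extend E u) (mdifferentiableAt_extend ..) hY hZ
  simpa using this

theorem mvfderiv_congr {f g : M → ℝ} {x : M} (h : f =ᶠ[𝓝 x] g) :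
    (d% f x : TangentSpace I x →L[ℝ] ℝ) = d% g x := by
  simp only [mvfderiv]
  rw [h.mfderiv_eq]
  rfl

/-- The curvature operator on vector fields,
`R(X, Y) Z = D_X D_Y Z - D_Y D_X Z - D_[X, Y] Z`. -/
def curvatureField (X Y Z : Π x : M, TangentSpace I x) (x : M) : TangentSpace I x :=
  leviCivita I M (fun y ↦ leviCivita I M Z y (Y y)) x (X x)
    - leviCivita I M (fun y ↦ leviCivita I M Z y (X y)) x (Y x)
    - leviCivita I M Z x (mlieBracket I X Y x)

theorem curvature_eq_curvatureField (x : M) (u v w : TangentSpace I x) :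
    curvature x u v w = curvatureField (extend E u) (extend E v) (extend E w) x := by
  simp [curvature, curvatureField]

variable {X Y Z W : Π x : M, TangentSpace I x} {x : M}

theorem curvatureField_swap : curvatureField X Y Z x = - curvatureField Y X Z x := by
  have h : mlieBracket I Y X x = - mlieBracket I X Y x := mlieBracket_swap_apply
  simp only [curvatureField, h, map_neg]
  abel

/-- Apply `X Y - Y X - [X, Y] = 0` to the function `g(Z, W)`. -/
theorem inner_curvatureField_skew (hX : CMDiffAt ∞ (T% X) x) (hY : CMDiffAt ∞ (T% Y) x)
    (hZ : CMDiffAt ∞ (T% Z) x) (hW : CMDiffAt ∞ (T% W) x) :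
    inner ℝ (curvatureField X Y Z x) (W x) + inner ℝ (Z x) (curvatureField X Y W x) = 0 := by
  have second : ∀ {X Y : Π x : M, TangentSpace I x}, CMDiffAt ∞ (T% X) x → CMDiffAt ∞ (T% Y) x →
      d% (fun y ↦ d% (metricFun Z W) y (Y y)) x (X x) =
      inner ℝ (leviCivita I M (fun y ↦ leviCivita I M Z y (Y y)) x (X x)) (W x)
      + inner ℝ (leviCivita I M Z x (Y x)) (leviCivita I M W x (X x))
      + inner ℝ (leviCivita I M Z x (X x)) (leviCivita I M W x (Y x))
      + inner ℝ (Z x) (leviCivita I M (fun y ↦ leviCivita I M W y (Y y)) x (X x)) := by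
    intro X Y hX hY
    have hYZ := contMDiffAt_leviCivita hY hZ
    have hYW := contMDiffAt_leviCivita hY hW
    have e : (fun y ↦ d% (metricFun Z W) y (Y y)) =ᶠ[𝓝 x]
        metricFun (fun y ↦ leviCivita I M Z y (Y y)) W
          + metricFun Z (fun y ↦ leviCivita I M W y (Y y)) := by
      filter_upwards [eventually_mdiffAt hZ, eventually_mdiffAt hW] with y hZy hWy
      exact mvfderiv_metricFun hZy hWy (Y y)
    have e' : d% (fun y ↦ d% (metricFun Z W) y (Y y)) x =
        d% (metricFun (fun y ↦ leviCivita I M Z y (Y y)) W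
          + metricFun Z (fun y ↦ leviCivita I M W y (Y y))) x := mvfderiv_congr e
    rw [e', mvfderiv_add ((contMDiffAt_metricFun hYZ hW).mdifferentiableAt (by simp))
      ((contMDiffAt_metricFun hZ hYW).mdifferentiableAt (by simp)), add_apply,
      mvfderiv_metricFun (hYZ.mdifferentiableAt (by simp)) (hW.mdifferentiableAt (by simp)),
      mvfderiv_metricFun (hZ.mdifferentiableAt (by simp)) (hYW.mdifferentiableAt (by simp))]
    ring
  have h1 := mvfderiv_mlieBracket (contMDiffAt_metricFun hZ hW) hX hY
  rw [second hX hY, second hY hX, mvfderiv_metricFun (hZ.mdifferentiableAt (by simp))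
    (hW.mdifferentiableAt (by simp))] at h1
  simp only [curvatureField, inner_sub_left, inner_sub_right]
  linarith

/-- The first Bianchi identity. As `D` has no torsion, it reduces to the Jacobi identity. -/
theorem curvatureField_bianchi (hX : CMDiffAt ∞ (T% X) x) (hY : CMDiffAt ∞ (T% Y) x)
    (hZ : CMDiffAt ∞ (T% Z) x) :
    curvatureField X Y Z x + curvatureField Y Z X x + curvatureField Z X Y x = 0 := by
  have step : ∀ {X Y Z : Π x : M, TangentSpace I x}, CMDiffAt ∞ (T% X) x →
      CMDiffAt ∞ (T% Y) x → CMDiffAt ∞ (T% Z) x →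
      leviCivita I M (fun y ↦ leviCivita I M Z y (Y y)) x (X x) =
        leviCivita I M (fun y ↦ leviCivita I M Y y (Z y)) x (X x)
        + leviCivita I M X x (mlieBracket I Y Z x) + mlieBracket I X (mlieBracket I Y Z) x := by
    intro X Y Z hX hY hZ
    have h1 := (contMDiffAt_leviCivita hY hZ).mdifferentiableAt (by simp)
    have h2 := (contMDiffAt_leviCivita hZ hY).mdifferentiableAt (by simp)
    have h3 := (contMDiffAt_mlieBracket hY hZ).mdifferentiableAt (by simp)
    have e : (fun y ↦ leviCivita I M Z y (Y y)) =ᶠ[𝓝 x]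
        (fun y ↦ leviCivita I M Y y (Z y)) + mlieBracket I Y Z := by
      filter_upwards [eventually_mdiffAt hY, eventually_mdiffAt hZ] with y hYy hZy
      rw [Pi.add_apply, ← leviCivita_sub_leviCivita hYy hZy]
      abel
    rw [leviCivita_congr h1 (mdifferentiableAt_add_section h2 h3) e, leviCivita_add h2 h3,
      ← leviCivita_sub_leviCivita (hX.mdifferentiableAt (by simp)) h3]
    abel
  have j := jacobi_mlieBracket hX hY hZ
  have j1 : mlieBracket I (mlieBracket I X Y) Z x = - mlieBracket I Z (mlieBracket I X Y) x :=
    mlieBracket_swap_apply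
  have j2 : mlieBracket I Y (mlieBracket I Z X) x = - mlieBracket I Y (mlieBracket I X Z) x := by
    have : mlieBracket I Z X = (fun _ : M ↦ (-1 : ℝ)) • mlieBracket I X Z := by
      rw [mlieBracket_swap]; ext y; simp
    rw [this]
    have h := (contMDiffAt_mlieBracket hX hZ).mdifferentiableAt (by simp)
    rw [mlieBracket_smul_right mdifferentiableAt_const h, mvfderiv_const]
    simp
  simp only [curvatureField]
  rw [step hX hY hZ, step hY hZ hX, step hZ hX hY, j, j1, j2]
  abel

/-- The pair symmetry, a formal consequence of the skew symmetries and the Bianchi identity. -/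
theorem inner_curvatureField_pair (hX : CMDiffAt ∞ (T% X) x) (hY : CMDiffAt ∞ (T% Y) x)
    (hZ : CMDiffAt ∞ (T% Z) x) (hW : CMDiffAt ∞ (T% W) x) :
    inner ℝ (curvatureField X Y Z x) (W x) = inner ℝ (curvatureField Z W X x) (Y x) := by
  have b : ∀ {X Y Z W : Π x : M, TangentSpace I x}, CMDiffAt ∞ (T% X) x → CMDiffAt ∞ (T% Y) x →
      CMDiffAt ∞ (T% Z) x → inner ℝ (curvatureField X Y Z x) (W x) +
        inner ℝ (curvatureField Y Z X x) (W x) + inner ℝ (curvatureField Z X Y x) (W x) = 0 := by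
    intro X Y Z W hX hY hZ
    rw [← inner_add_left, ← inner_add_left, curvatureField_bianchi hX hY hZ, inner_zero_left]
  have a : ∀ {X Y Z W : Π x : M, TangentSpace I x}, inner ℝ (curvatureField X Y Z x) (W x) =
      - inner ℝ (curvatureField Y X Z x) (W x) := by
    intro X Y Z W
    rw [curvatureField_swap, inner_neg_left]
  have s : ∀ {X Y Z W : Π x : M, TangentSpace I x}, CMDiffAt ∞ (T% X) x → CMDiffAt ∞ (T% Y) x →
      CMDiffAt ∞ (T% Z) x → CMDiffAt ∞ (T% W) x → inner ℝ (curvatureField X Y Z x) (W x) =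
      - inner ℝ (curvatureField X Y W x) (Z x) := by
    intro X Y Z W hX hY hZ hW
    have h := inner_curvatureField_skew hX hY hZ hW
    rw [real_inner_comm (curvatureField X Y W x)] at h
    linarith
  have b1 := b (W := W) hX hY hZ
  have b2 := b (W := X) hY hZ hW
  have b3 := b (W := Y) hZ hW hX
  have b4 := b (W := Z) hW hX hY
  have s1 := s hX hY hZ hW
  have s2 := s hY hZ hX hW
  have s3 := s hZ hX hY hW
  have s4 := s hZ hW hX hY
  have s5 := s hY hW hX hZ
  have s6 := s hX hW hY hZ
  have a1 := a (X := W) (Y := X) (Z := Y) (W := Z)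
  have a2 := a (X := W) (Y := Y) (Z := Z) (W := X)
  have a3 := a (X := W) (Y := X) (Z := Z) (W := Y)
  have a4 := a (X := W) (Y := Y) (Z := X) (W := Z)
  have a5 := a (X := X) (Y := Z) (Z := W) (W := Y)
  have a6 := a (X := W) (Y := Z) (Z := X) (W := Y)
  linarith

/-- The value of `R(X, Y) Z` at `x` depends only on the values of the fields at `x`: for `Z` this
follows from skewness, for `X` and `Y` from the pair symmetry. -/
theorem curvatureField_eq (hX : CMDiffAt ∞ (T% X) x) (hY : CMDiffAt ∞ (T% Y) x)
    (hZ : CMDiffAt ∞ (T% Z) x) : curvatureField X Y Z x = curvature x (X x) (Y x) (Z x) := by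
  have third : ∀ {X Y Z Z' : Π x : M, TangentSpace I x}, CMDiffAt ∞ (T% X) x →
      CMDiffAt ∞ (T% Y) x → CMDiffAt ∞ (T% Z) x → CMDiffAt ∞ (T% Z') x → Z x = Z' x →
      curvatureField X Y Z x = curvatureField X Y Z' x := by
    intro X Y Z Z' hX hY hZ hZ' h
    refine ext_inner_right ℝ fun w ↦ ?_
    have hw : CMDiffAt ∞ (T% (extend E w)) x := contMDiffAt_extend ..
    have h1 := inner_curvatureField_skew hX hY hZ hw
    have h2 := inner_curvatureField_skew hX hY hZ' hw
    rw [extend_apply_self] at h1 h2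
    rw [h] at h1
    linarith
  have first : ∀ {X X' Y Z : Π x : M, TangentSpace I x}, CMDiffAt ∞ (T% X) x →
      CMDiffAt ∞ (T% X') x → CMDiffAt ∞ (T% Y) x → CMDiffAt ∞ (T% Z) x → X x = X' x →
      curvatureField X Y Z x = curvatureField X' Y Z x := by
    intro X X' Y Z hX hX' hY hZ h
    refine ext_inner_right ℝ fun w ↦ ?_
    have hw : CMDiffAt ∞ (T% (extend E w)) x := contMDiffAt_extend ..
    have h1 := inner_curvatureField_pair hX hY hZ hw
    have h2 := inner_curvatureField_pair hX' hY hZ hw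
    rw [extend_apply_self] at h1 h2
    rw [h1, h2, third hZ hw hX hX' h]
  have ext' (Z : Π x : M, TangentSpace I x) : CMDiffAt ∞ (T% (extend E (Z x))) x :=
    contMDiffAt_extend ..
  rw [curvature_eq_curvatureField, first hX (ext' X) hY hZ (by simp), curvatureField_swap,
    first hY (ext' Y) (ext' X) hZ (by simp), ← curvatureField_swap,
    third (ext' X) (ext' Y) hZ (ext' Z) (by simp)]

theorem inner_curvature_skew (u v w z : TangentSpace I x) :
    inner ℝ (curvature x u v w) z + inner ℝ w (curvature x u v z) = 0 := by
  have h (u : TangentSpace I x) : CMDiffAt ∞ (T% (extend E u)) x := contMDiffAt_extend ..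
  simpa [curvature_eq_curvatureField] using inner_curvatureField_skew (h u) (h v) (h w) (h z)

theorem curvature_bianchi (u v w : TangentSpace I x) :
    curvature x u v w + curvature x v w u + curvature x w u v = 0 := by
  have h (u : TangentSpace I x) : CMDiffAt ∞ (T% (extend E u)) x := contMDiffAt_extend ..
  simpa [curvature_eq_curvatureField] using curvatureField_bianchi (h u) (h v) (h w)

theorem inner_curvature_pair (u v w z : TangentSpace I x) :
    inner ℝ (curvature x u v w) z = inner ℝ (curvature x w z u) v := by
  have h (u : TangentSpace I x) : CMDiffAt ∞ (T% (extend E u)) x := contMDiffAt_extend ..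
  simpa [curvature_eq_curvatureField] using inner_curvatureField_pair (h u) (h v) (h w) (h z)

end Curvature

/-! ### Skew endomorphisms of an oriented Euclidean 4-space -/

section SkewEndomorphisms
variable {V : Type*} [NormedAddCommGroup V] [InnerProductSpace ℝ V]

/-- A map of a Euclidean space is skew if `⟨A u, v⟩ = -⟨u, A v⟩`. Such a map is automatically
linear. -/
def IsSkew (A : V → V) : Prop := ∀ u v : V, inner ℝ (A u) v + inner ℝ u (A v) = 0

variable {A B : V → V}

theorem IsSkew.inner_swap (hA : IsSkew A) (u v : V) : inner ℝ (A u) v = - inner ℝ (A v) u := by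
  rw [real_inner_comm u (A v)]
  linarith [hA u v]

theorem IsSkew.smul (c : ℝ) (hA : IsSkew A) : IsSkew (c • A) := by
  intro u v
  simp only [Pi.smul_apply, real_inner_smul_left, real_inner_smul_right]
  linear_combination c * hA u v

theorem IsSkew.sub (hA : IsSkew A) (hB : IsSkew B) : IsSkew (A - B) := by
  intro u v
  simp only [Pi.sub_apply, inner_sub_left, inner_sub_right]
  linarith [hA u v, hB u v]

theorem IsSkew.map_add (hA : IsSkew A) (u v : V) : A (u + v) = A u + A v := by
  refine ext_inner_right ℝ fun w ↦ ?_
  rw [hA.inner_swap, inner_add_left, hA.inner_swap u, hA.inner_swap v, inner_add_right]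
  ring

theorem IsSkew.map_smul (hA : IsSkew A) (c : ℝ) (u : V) : A (c • u) = c • A u := by
  refine ext_inner_right ℝ fun w ↦ ?_
  rw [hA.inner_swap, real_inner_smul_left, hA.inner_swap u, real_inner_smul_right]
  ring

/-- A skew map as a linear map. -/
def IsSkew.toLinearMap (hA : IsSkew A) : V →ₗ[ℝ] V where
  toFun := A
  map_add' := hA.map_add
  map_smul' := hA.map_smul

theorem IsSkew.ext_basis {ι : Type*} [Fintype ι] (e : OrthonormalBasis ι ℝ V) (hA : IsSkew A)
    (hB : IsSkew B) (h : ∀ i j, inner ℝ (A (e i)) (e j) = inner ℝ (B (e i)) (e j)) : A = B := by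
  have : hA.toLinearMap = hB.toLinearMap := by
    refine e.toBasis.ext fun i ↦ ?_
    refine InnerProductSpace.ext_inner_right_basis e.toBasis fun j ↦ ?_
    simp only [OrthonormalBasis.coe_toBasis]
    exact h i j
  exact congrArg DFunLike.coe this

theorem isSkew_of_orthonormalBasis {ι : Type*} [Fintype ι] (e : OrthonormalBasis ι ℝ V)
    (L : V →ₗ[ℝ] V) (h : ∀ i j, inner ℝ (L (e i)) (e j) + inner ℝ (L (e j)) (e i) = 0) :
    IsSkew L := by
  have key : (innerₗ V).compl₁₂ L LinearMap.id + (innerₗ V).compl₁₂ LinearMap.id L = 0 := by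
    refine LinearMap.ext_basis e.toBasis e.toBasis fun i j ↦ ?_
    simpa [real_inner_comm] using h i j
  intro u v
  simpa using LinearMap.congr_fun₂ key u v

/-- In dimension four, a skew map is determined by six of its matrix entries. -/
theorem IsSkew.ext_frame (e : OrthonormalBasis (Fin 4) ℝ V) (hA : IsSkew A) (hB : IsSkew B)
    (h01 : inner ℝ (A (e 0)) (e 1) = inner ℝ (B (e 0)) (e 1))
    (h02 : inner ℝ (A (e 0)) (e 2) = inner ℝ (B (e 0)) (e 2))
    (h03 : inner ℝ (A (e 0)) (e 3) = inner ℝ (B (e 0)) (e 3))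
    (h12 : inner ℝ (A (e 1)) (e 2) = inner ℝ (B (e 1)) (e 2))
    (h13 : inner ℝ (A (e 1)) (e 3) = inner ℝ (B (e 1)) (e 3))
    (h23 : inner ℝ (A (e 2)) (e 3) = inner ℝ (B (e 2)) (e 3)) : A = B := by
  refine IsSkew.ext_basis e hA hB fun i j ↦ ?_
  have a (k) := hA.inner_swap (e k) (e k)
  have b (k) := hB.inner_swap (e k) (e k)
  have a' (k l) := hA.inner_swap (e k) (e l)
  have b' (k l) := hB.inner_swap (e k) (e l)
  fin_cases i <;> fin_cases j <;> simp only [Fin.zero_eta, Fin.mk_one, Fin.reduceFinMk] <;>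
    first
    | assumption
    | linarith [a 0, a 1, a 2, a 3, b 0, b 1, b 2, b 3]
    | linarith [a' 1 0, a' 2 0, a' 3 0, a' 2 1, a' 3 1, a' 3 2,
        b' 1 0, b' 2 0, b' 3 0, b' 2 1, b' 3 1, b' 3 2]

/-- The scalar product of two linear forms, computed in an orthonormal basis. As the right hand side
does not involve the basis, this allows a change of basis in such sums. -/
theorem sum_mul_eq_inner_toDual_symm {ι : Type*} [Fintype ι] [FiniteDimensional ℝ V]
    (b : OrthonormalBasis ι ℝ V) (f g : V →ₗ[ℝ] ℝ) : ∑ i, f (b i) * g (b i) =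
      inner ℝ ((InnerProductSpace.toDual ℝ V).symm f.toContinuousLinearMap)
        ((InnerProductSpace.toDual ℝ V).symm g.toContinuousLinearMap) := by
  rw [← b.sum_inner_mul_inner]
  refine Finset.sum_congr rfl fun i _ ↦ ?_
  rw [InnerProductSpace.toDual_symm_apply, real_inner_comm, InnerProductSpace.toDual_symm_apply]
  rfl

/-- The linear form dual to `G`, wedged with `u`: the skew endomorphism
`v ↦ ⟨G, v⟩ u - ⟨u, v⟩ G`. -/
def wedgeHom (G u : V) : V →L[ℝ] V :=
  (innerSL ℝ G).smulRight u - (innerSL ℝ u).smulRight G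

theorem wedgeHom_apply (G u v : V) :
    wedgeHom G u v = (inner ℝ G v : ℝ) • u - (inner ℝ u v : ℝ) • G := by
  simp [wedgeHom]

theorem isSkew_wedgeHom (G u : V) : IsSkew (wedgeHom G u) := by
  intro v w
  simp only [wedgeHom_apply, inner_sub_left, inner_sub_right, real_inner_smul_left,
    real_inner_smul_right, real_inner_comm v]
  ring

variable [FiniteDimensional ℝ V]

theorem inner_sharp (γ : V →L[ℝ] ℝ) (v : V) : inner ℝ (sharp γ) v = γ v := by
  conv_rhs => rw [← (stdOrthonormalBasis ℝ V).sum_repr' v]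
  simp [sharp, sum_inner, real_inner_smul_left, mul_comm]

theorem wedge_eq_wedgeHom (γ : V →L[ℝ] ℝ) (u : V) : wedge γ u = wedgeHom (sharp γ) u := by
  ext v
  rw [wedge, wedgeHom_apply, inner_sharp]

end SkewEndomorphisms

section HodgeStar
variable {V : Type*} [NormedAddCommGroup V] [InnerProductSpace ℝ V] [FiniteDimensional ℝ V]
  [Fact (finrank ℝ V = 4)] (o : Orientation ℝ V (Fin 4)) {A B : V → V}

theorem volumeForm_swap₀₁ (a b c d : V) :
    o.volumeForm ![a, b, c, d] = - o.volumeForm ![b, a, c, d] := by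
  rw [← o.volumeForm.map_swap ![b, a, c, d] (show (0 : Fin 4) ≠ 1 by decide)]
  congr 1; ext i; fin_cases i <;> rfl

theorem volumeForm_swap₁₂ (a b c d : V) :
    o.volumeForm ![a, b, c, d] = - o.volumeForm ![a, c, b, d] := by
  rw [← o.volumeForm.map_swap ![a, c, b, d] (show (1 : Fin 4) ≠ 2 by decide)]
  congr 1; ext i; fin_cases i <;> rfl

theorem volumeForm_swap₂₃ (a b c d : V) :
    o.volumeForm ![a, b, c, d] = - o.volumeForm ![a, b, d, c] := by
  rw [← o.volumeForm.map_swap ![a, b, d, c] (show (2 : Fin 4) ≠ 3 by decide)]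
  congr 1; ext i; fin_cases i <;> rfl

theorem volumeForm_self₀₁ (a c d : V) : o.volumeForm ![a, a, c, d] = 0 :=
  o.volumeForm.map_eq_zero_of_eq _ (i := 0) (j := 1) rfl (by decide)

theorem volumeForm_self₀₂ (a c d : V) : o.volumeForm ![a, c, a, d] = 0 :=
  o.volumeForm.map_eq_zero_of_eq _ (i := 0) (j := 2) rfl (by decide)

theorem volumeForm_self₀₃ (a c d : V) : o.volumeForm ![a, c, d, a] = 0 :=
  o.volumeForm.map_eq_zero_of_eq _ (i := 0) (j := 3) rfl (by decide)

theorem volumeForm_self₁₂ (a c d : V) : o.volumeForm ![c, a, a, d] = 0 :=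
  o.volumeForm.map_eq_zero_of_eq _ (i := 1) (j := 2) rfl (by decide)

theorem volumeForm_self₁₃ (a c d : V) : o.volumeForm ![c, a, d, a] = 0 :=
  o.volumeForm.map_eq_zero_of_eq _ (i := 1) (j := 3) rfl (by decide)

/-- The volume form as a linear form in its last argument. -/
def volumeFormLast (a b c : V) : V →ₗ[ℝ] ℝ :=
  o.volumeForm.toMultilinearMap.toLinearMap ![a, b, c, 0] 3

theorem volumeFormLast_apply (a b c d : V) :
    volumeFormLast o a b c d = o.volumeForm ![a, b, c, d] := by
  rw [volumeFormLast, MultilinearMap.toLinearMap_apply]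
  refine congrArg o.volumeForm ?_
  ext i; fin_cases i <;> rfl

/-- The defining formula of the Hodge star holds in every orthonormal basis. -/
theorem inner_hodgeStar {ι : Type*} [Fintype ι] (e : OrthonormalBasis ι ℝ V) (hA : IsSkew A)
    (u v : V) : inner ℝ (hodgeStar o A u) v =
      2⁻¹ * ∑ i, ∑ j, inner ℝ (A (e i)) (e j) * o.volumeForm ![e i, e j, u, v] := by
  set b := stdOrthonormalBasis ℝ V with hb
  have h1 : inner ℝ (hodgeStar o A u) v =
      2⁻¹ * ∑ i, ∑ j, inner ℝ (A (b i)) (b j) * o.volumeForm ![b i, b j, u, v] := by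
    simp only [hodgeStar, real_inner_smul_left, sum_inner, ← hb]
    congr 1
    refine Finset.sum_congr rfl fun i _ ↦ Finset.sum_congr rfl fun j _ ↦ ?_
    have : o.volumeForm ![b i, b j, u, v] =
        ∑ k, inner ℝ (b k) v * o.volumeForm ![b i, b j, u, b k] := by
      rw [← volumeFormLast_apply]
      conv_lhs => rw [← b.sum_repr' v]
      simp [volumeFormLast_apply]
    rw [this, Finset.mul_sum]
    refine Finset.sum_congr rfl fun k _ ↦ ?_
    ring
  -- The two indices are changed from one basis to the other in turn.
  have hv (x y : V) : o.volumeForm ![x, y, u, v] = volumeFormLast o u v x y := by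
    rw [volumeFormLast_apply, volumeForm_swap₁₂, volumeForm_swap₀₁, volumeForm_swap₂₃,
      volumeForm_swap₁₂]
    ring
  have hv' (x y : V) : o.volumeForm ![x, y, u, v] = - volumeFormLast o u v y x := by
    rw [volumeForm_swap₀₁, hv]
  rw [h1]
  congr 1
  calc ∑ i, ∑ j, inner ℝ (A (b i)) (b j) * o.volumeForm ![b i, b j, u, v]
      = ∑ i, ∑ j, inner ℝ (A (b i)) (e j) * o.volumeForm ![b i, e j, u, v] := by
        refine Finset.sum_congr rfl fun i _ ↦ ?_
        simp only [hv]
        exact (sum_mul_eq_inner_toDual_symm b (innerₛₗ ℝ (A (b i)))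
          (volumeFormLast o u v (b i))).trans (sum_mul_eq_inner_toDual_symm e _ _).symm
    _ = ∑ j, ∑ i, inner ℝ (A (b i)) (e j) * o.volumeForm ![b i, e j, u, v] := Finset.sum_comm
    _ = ∑ j, ∑ i, inner ℝ (A (e i)) (e j) * o.volumeForm ![e i, e j, u, v] := by
        refine Finset.sum_congr rfl fun j _ ↦ ?_
        simp only [hv', hA.inner_swap _ (e j), neg_mul_neg]
        exact (sum_mul_eq_inner_toDual_symm b (innerₛₗ ℝ (A (e j)))
          (volumeFormLast o u v (e j))).trans (sum_mul_eq_inner_toDual_symm e _ _).symm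
    _ = ∑ i, ∑ j, inner ℝ (A (e i)) (e j) * o.volumeForm ![e i, e j, u, v] := Finset.sum_comm

theorem isSkew_hodgeStar (hA : IsSkew A) : IsSkew (hodgeStar o A) := by
  intro u v
  rw [← real_inner_comm u, inner_hodgeStar o (stdOrthonormalBasis ℝ V) hA,
    inner_hodgeStar o (stdOrthonormalBasis ℝ V) hA]
  simp only [fun a b : V ↦ volumeForm_swap₂₃ o a b v u, mul_neg, Finset.sum_neg_distrib]
  ring

theorem isSkew_asdPart (hA : IsSkew A) : IsSkew (asdPart o A) :=
  (hA.sub (isSkew_hodgeStar o hA)).smul 2⁻¹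

variable {o} {e : OrthonormalBasis (Fin 4) ℝ V}

theorem volumeForm_frame (he : e.toBasis.orientation = o) :
    o.volumeForm ![e 0, e 1, e 2, e 3] = 1 := by
  rw [o.volumeForm_robust e he, ← e.toBasis.det_self]
  congr 1; ext i; fin_cases i <;> simp

/-- In an oriented orthonormal frame, `⋆ (e⁰ ∧ e¹) = e² ∧ e³` and its analogues. -/
theorem hodgeStar_frame (he : e.toBasis.orientation = o) (hA : IsSkew A) :
    inner ℝ (hodgeStar o A (e 0)) (e 1) = inner ℝ (A (e 2)) (e 3) ∧
    inner ℝ (hodgeStar o A (e 0)) (e 2) = - inner ℝ (A (e 1)) (e 3) ∧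
    inner ℝ (hodgeStar o A (e 0)) (e 3) = inner ℝ (A (e 1)) (e 2) ∧
    inner ℝ (hodgeStar o A (e 1)) (e 2) = inner ℝ (A (e 0)) (e 3) ∧
    inner ℝ (hodgeStar o A (e 1)) (e 3) = - inner ℝ (A (e 0)) (e 2) ∧
    inner ℝ (hodgeStar o A (e 2)) (e 3) = inner ℝ (A (e 0)) (e 1) := by
  have v := volumeForm_frame he
  have v₁ : o.volumeForm ![e 2, e 3, e 0, e 1] = 1 := by
    rw [volumeForm_swap₁₂, volumeForm_swap₀₁, volumeForm_swap₂₃, volumeForm_swap₁₂, v]; norm_num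
  have v₂ : o.volumeForm ![e 1, e 3, e 0, e 2] = -1 := by
    rw [volumeForm_swap₁₂, volumeForm_swap₀₁, volumeForm_swap₂₃, v]; norm_num
  have v₃ : o.volumeForm ![e 1, e 2, e 0, e 3] = 1 := by
    rw [volumeForm_swap₁₂, volumeForm_swap₀₁, v]; simp
  have v₄ : o.volumeForm ![e 0, e 3, e 1, e 2] = 1 := by
    rw [volumeForm_swap₁₂, volumeForm_swap₂₃, v]; simp
  have v₅ : o.volumeForm ![e 0, e 2, e 1, e 3] = -1 := by
    rw [volumeForm_swap₁₂, v]
  have w₁ : o.volumeForm ![e 3, e 2, e 0, e 1] = -1 := by rw [volumeForm_swap₀₁, v₁]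
  have w₂ : o.volumeForm ![e 3, e 1, e 0, e 2] = 1 := by rw [volumeForm_swap₀₁, v₂]; simp
  have w₃ : o.volumeForm ![e 2, e 1, e 0, e 3] = -1 := by rw [volumeForm_swap₀₁, v₃]
  have w₄ : o.volumeForm ![e 3, e 0, e 1, e 2] = -1 := by rw [volumeForm_swap₀₁, v₄]
  have w₅ : o.volumeForm ![e 2, e 0, e 1, e 3] = 1 := by rw [volumeForm_swap₀₁, v₅]; simp
  have w₆ : o.volumeForm ![e 1, e 0, e 2, e 3] = -1 := by rw [volumeForm_swap₀₁, v]
  have a (k l) := hA.inner_swap (e k) (e l)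
  refine ⟨?_, ?_, ?_, ?_, ?_, ?_⟩ <;>
    simp only [inner_hodgeStar o e hA, Fin.sum_univ_four, volumeForm_self₀₁, volumeForm_self₀₂,
      volumeForm_self₀₃, volumeForm_self₁₂, volumeForm_self₁₃, v, v₁, v₂, v₃,
      v₄, v₅, w₁, w₂, w₃, w₄, w₅, w₆] <;>
    linarith [a 1 0, a 2 0, a 3 0, a 2 1, a 3 1, a 3 2]

theorem asdPart_frame (he : e.toBasis.orientation = o) (hA : IsSkew A) :
    inner ℝ (asdPart o A (e 0)) (e 1) = 2⁻¹ * (inner ℝ (A (e 0)) (e 1) - inner ℝ (A (e 2)) (e 3)) ∧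
    inner ℝ (asdPart o A (e 0)) (e 2) = 2⁻¹ * (inner ℝ (A (e 0)) (e 2) + inner ℝ (A (e 1)) (e 3)) ∧
    inner ℝ (asdPart o A (e 0)) (e 3) = 2⁻¹ * (inner ℝ (A (e 0)) (e 3) - inner ℝ (A (e 1)) (e 2)) ∧
    inner ℝ (asdPart o A (e 1)) (e 2) = 2⁻¹ * (inner ℝ (A (e 1)) (e 2) - inner ℝ (A (e 0)) (e 3)) ∧
    inner ℝ (asdPart o A (e 1)) (e 3) = 2⁻¹ * (inner ℝ (A (e 1)) (e 3) + inner ℝ (A (e 0)) (e 2)) ∧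
    inner ℝ (asdPart o A (e 2)) (e 3) =
      2⁻¹ * (inner ℝ (A (e 2)) (e 3) - inner ℝ (A (e 0)) (e 1)) := by
  obtain ⟨h1, h2, h3, h4, h5, h6⟩ := hodgeStar_frame he hA
  simp only [asdPart, real_inner_smul_left, inner_sub_left, h1, h2, h3, h4, h5, h6, sub_neg_eq_add]
  simp

variable (o) in
theorem exists_oriented_orthonormalBasis :
    ∃ e : OrthonormalBasis (Fin 4) ℝ V, e.toBasis.orientation = o :=
  ⟨o.finOrthonormalBasis (by norm_num) Fact.out,
    o.finOrthonormalBasis_orientation (by norm_num) Fact.out⟩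

theorem hodgeStar_asdPart (hA : IsSkew A) : hodgeStar o (asdPart o A) = - asdPart o A := by
  obtain ⟨e, he⟩ := exists_oriented_orthonormalBasis o
  have hB := isSkew_asdPart o hA
  obtain ⟨h1, h2, h3, h4, h5, h6⟩ := hodgeStar_frame he hB
  obtain ⟨k1, k2, k3, k4, k5, k6⟩ := asdPart_frame he hA
  have hn : IsSkew (- asdPart o A) := by simpa using hB.smul (-1)
  refine IsSkew.ext_frame e (isSkew_hodgeStar o hB) hn ?_ ?_ ?_ ?_ ?_ ?_ <;>
    simp only [Pi.neg_apply, inner_neg_left, *] <;> ring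

variable (o) in
/-- The antiselfdual part of a skew endomorphism, as a linear endomorphism. -/
def asdHom (A : V →L[ℝ] V) (hA : IsSkew A) : V →L[ℝ] V :=
  (isSkew_asdPart o hA).toLinearMap.toContinuousLinearMap

theorem asdHom_apply (A : V →L[ℝ] V) (hA : IsSkew A) (u : V) :
    asdHom o A hA u = asdPart o A u := rfl

variable (o) in
theorem asdPart_sub (A B : V → V) : asdPart o (A - B) = asdPart o A - asdPart o B := by
  have h : A - B = A + (-1 : ℝ) • B := by
    ext u; simp [sub_eq_add_neg]
  ext u
  rw [h, asdPart_add, asdPart_smul]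
  simp [sub_eq_add_neg]

theorem inner_wedgeHom (G u v w : V) : inner ℝ (wedgeHom G u v) w =
    inner ℝ G v * inner ℝ u w - inner ℝ u v * inner ℝ G w := by
  rw [wedgeHom_apply, inner_sub_left, real_inner_smul_left, real_inner_smul_left]

theorem inner_frame (e : OrthonormalBasis (Fin 4) ℝ V) (i j : Fin 4) :
    inner ℝ (e i) (e j) = if i = j then (1 : ℝ) else 0 :=
  orthonormal_iff_ite.mp e.orthonormal i j

/-- The linear map `G ↦ (u ↦ (G ∧ u)⁻)` is injective. -/
theorem eq_zero_of_asdPart_wedgeHom_eq_zero {G : V}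
    (h : ∀ u, asdPart o (wedgeHom G u) = 0) : G = 0 := by
  obtain ⟨e, he⟩ := exists_oriented_orthonormalBasis o
  have k (i : Fin 4) := (asdPart_frame he (isSkew_wedgeHom G (e i))).1
  -- The entry `(0, 1)` of `(G ∧ e i)⁻` is, up to sign and a factor `1/2`, one component of `G`.
  have k0 := k 0
  have k1 := k 1
  have k2 := k 2
  have k3 := k 3
  simp only [h, inner_wedgeHom, inner_frame] at k0 k1 k2 k3
  simp at k0 k1 k2 k3
  refine InnerProductSpace.ext_inner_right_basis e.toBasis fun i ↦ ?_
  fin_cases i <;> simp [*]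

/-- Selfdual and antiselfdual skew endomorphisms commute, so only the antiselfdual part of `A`
contributes to the commutator with an antiselfdual `Ψ`. The entries of `[A, Ψ]`. -/
theorem commutator_frame {Ψ : V → V} (he : e.toBasis.orientation = o) (hA : IsSkew A)
    (hΨ : IsSkew Ψ) (hasd : hodgeStar o Ψ = - Ψ) :
    inner ℝ (A (Ψ (e 0)) - Ψ (A (e 0))) (e 1) =
      2 * (inner ℝ (asdPart o A (e 0)) (e 3) * inner ℝ (Ψ (e 0)) (e 2)
        - inner ℝ (asdPart o A (e 0)) (e 2) * inner ℝ (Ψ (e 0)) (e 3)) ∧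
    inner ℝ (A (Ψ (e 0)) - Ψ (A (e 0))) (e 2) =
      2 * (inner ℝ (asdPart o A (e 0)) (e 1) * inner ℝ (Ψ (e 0)) (e 3)
        - inner ℝ (asdPart o A (e 0)) (e 3) * inner ℝ (Ψ (e 0)) (e 1)) ∧
    inner ℝ (A (Ψ (e 0)) - Ψ (A (e 0))) (e 3) =
      2 * (inner ℝ (asdPart o A (e 0)) (e 2) * inner ℝ (Ψ (e 0)) (e 1)
        - inner ℝ (asdPart o A (e 0)) (e 1) * inner ℝ (Ψ (e 0)) (e 2)) := by
  have expand {P Q : V → V} (hP : IsSkew P) (u v : V) :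
      inner ℝ (P (Q u)) v = - ∑ m, inner ℝ (Q u) (e m) * inner ℝ (P v) (e m) := by
    have := e.sum_inner_mul_inner (Q u) (P v)
    simp only [real_inner_comm (P v)] at this
    rw [this, hP.inner_swap, real_inner_comm]
  obtain ⟨h1, h2, h3, -, -, -⟩ := hodgeStar_frame he hΨ
  obtain ⟨k1, k2, k3, -, -, -⟩ := asdPart_frame he hA
  simp only [hasd, Pi.neg_apply, inner_neg_left] at h1 h2 h3
  have a (k l) := hA.inner_swap (e k) (e l)
  have p (k l) := hΨ.inner_swap (e k) (e l)
  have a0 (k) : inner ℝ (A (e k)) (e k) = 0 := by linarith [a k k]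
  have p0 (k) : inner ℝ (Ψ (e k)) (e k) = 0 := by linarith [p k k]
  have h1' : inner ℝ (Ψ (e 2)) (e 3) = - inner ℝ (Ψ (e 0)) (e 1) := by linarith
  have h2' : inner ℝ (Ψ (e 1)) (e 3) = inner ℝ (Ψ (e 0)) (e 2) := by linarith
  have h3' : inner ℝ (Ψ (e 1)) (e 2) = - inner ℝ (Ψ (e 0)) (e 3) := by linarith
  refine ⟨?_, ?_, ?_⟩ <;>
    simp only [inner_sub_left, expand hA, expand hΨ, Fin.sum_univ_four, k1, k2, k3, a 1 0, a 2 0,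
      a 3 0, a 2 1, a 3 1, a 3 2, p 1 0, p 2 0, p 3 0, p 2 1, p 3 1, p 3 2, a0, p0,
      h1', h2', h3'] <;>
    ring

/-- The commutator identity of `isSkew_and_asdPart_eq_of_commutator`, read off on the vectors
`e i`, `e j` of an oriented orthonormal frame. -/
theorem commutator_identity_frame {Ψ : V → V} {L : V → V} {R : V → V → V → V} {c : ℝ}
    (he : e.toBasis.orientation = o)
    (hΨ : IsSkew Ψ) (hasd : hodgeStar o Ψ = - Ψ) (hR : ∀ u v, IsSkew (R u v))
    (hRasd : ∀ u v, asdPart o (R u v) = c • asdPart o (wedgeHom v u))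
    (h : ∀ u v w, asdPart o (wedgeHom (L u) v - wedgeHom (L v) u) w = R u v (Ψ w) - Ψ (R u v w))
    {b δ : Fin 4 → Fin 4 → ℝ} (hb : ∀ i j, b i j = inner ℝ (L (e i)) (e j))
    (hδ : ∀ i j, δ i j = inner ℝ (e i) (e j)) {p₁ p₂ p₃ : ℝ} (hp₁ : p₁ = inner ℝ (Ψ (e 0)) (e 1))
    (hp₂ : p₂ = inner ℝ (Ψ (e 0)) (e 2)) (hp₃ : p₃ = inner ℝ (Ψ (e 0)) (e 3)) (i j : Fin 4) :
    b i 0 * δ j 1 - δ j 0 * b i 1 - (b j 0 * δ i 1 - δ i 0 * b j 1)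
      - (b i 2 * δ j 3 - δ j 2 * b i 3 - (b j 2 * δ i 3 - δ i 2 * b j 3)) =
      2 * c * ((δ j 0 * δ i 3 - δ i 0 * δ j 3 - (δ j 1 * δ i 2 - δ i 1 * δ j 2)) * p₂
        - (δ j 0 * δ i 2 - δ i 0 * δ j 2 + (δ j 1 * δ i 3 - δ i 1 * δ j 3)) * p₃) ∧
    b i 0 * δ j 2 - δ j 0 * b i 2 - (b j 0 * δ i 2 - δ i 0 * b j 2)
      + (b i 1 * δ j 3 - δ j 1 * b i 3 - (b j 1 * δ i 3 - δ i 1 * b j 3)) =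
      2 * c * ((δ j 0 * δ i 1 - δ i 0 * δ j 1 - (δ j 2 * δ i 3 - δ i 2 * δ j 3)) * p₃
        - (δ j 0 * δ i 3 - δ i 0 * δ j 3 - (δ j 1 * δ i 2 - δ i 1 * δ j 2)) * p₁) ∧
    b i 0 * δ j 3 - δ j 0 * b i 3 - (b j 0 * δ i 3 - δ i 0 * b j 3)
      - (b i 1 * δ j 2 - δ j 1 * b i 2 - (b j 1 * δ i 2 - δ i 1 * b j 2)) =
      2 * c * ((δ j 0 * δ i 2 - δ i 0 * δ j 2 + (δ j 1 * δ i 3 - δ i 1 * δ j 3)) * p₁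
        - (δ j 0 * δ i 1 - δ i 0 * δ j 1 - (δ j 2 * δ i 3 - δ i 2 * δ j 3)) * p₂) := by
  obtain ⟨k₁, k₂, k₃⟩ := commutator_frame he (hR (e i) (e j)) hΨ hasd
  obtain ⟨a₁, a₂, a₃, -⟩ := asdPart_frame he
    ((isSkew_wedgeHom (L (e i)) (e j)).sub (isSkew_wedgeHom (L (e j)) (e i)))
  obtain ⟨b₁, b₂, b₃, -⟩ := asdPart_frame he (isSkew_wedgeHom (e j) (e i))
  simp only [Pi.sub_apply, inner_sub_left, inner_wedgeHom, ← hb, ← hδ] at a₁ a₂ a₃ b₁ b₂ b₃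
  rw [← h, hRasd, ← hp₂, ← hp₃, a₁, Pi.smul_apply, real_inner_smul_left, real_inner_smul_left,
    b₂, b₃] at k₁
  rw [← h, hRasd, ← hp₁, ← hp₃, a₂, Pi.smul_apply, real_inner_smul_left, real_inner_smul_left,
    b₁, b₃] at k₂
  rw [← h, hRasd, ← hp₁, ← hp₂, a₃, Pi.smul_apply, real_inner_smul_left, real_inner_smul_left,
    b₁, b₂] at k₃
  refine ⟨?_, ?_, ?_⟩
  · linear_combination 2 * k₁
  · linear_combination 2 * k₂
  · linear_combination 2 * k₃

/-- The algebraic content of the integrability condition of the twistor equation. With `L = D♯γ`,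
the trace and the tracefree symmetric part of `L` are forced to vanish, and the antiselfdual part
of its skew part to be `c Ψ`. -/
theorem isSkew_and_asdPart_eq_of_commutator {Ψ : V → V} (L : V →ₗ[ℝ] V) (R : V → V → V → V) (c : ℝ)
    (hΨ : IsSkew Ψ) (hasd : hodgeStar o Ψ = - Ψ) (hR : ∀ u v, IsSkew (R u v))
    (hRasd : ∀ u v, asdPart o (R u v) = c • asdPart o (wedgeHom v u))
    (h : ∀ u v w, asdPart o (wedgeHom (L u) v - wedgeHom (L v) u) w = R u v (Ψ w) - Ψ (R u v w)) :
    IsSkew L ∧ asdPart o L = c • Ψ := by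
  obtain ⟨e, he⟩ := exists_oriented_orthonormalBasis o
  obtain ⟨q₁, q₂, q₃, -⟩ := hodgeStar_frame he hΨ
  simp only [hasd, Pi.neg_apply, inner_neg_left] at q₁ q₂ q₃
  obtain ⟨b, hb⟩ : ∃ b : Fin 4 → Fin 4 → ℝ, ∀ i j, b i j = inner ℝ (L (e i)) (e j) :=
    ⟨_, fun _ _ ↦ rfl⟩
  obtain ⟨p₁, hp₁⟩ : ∃ p, p = inner ℝ (Ψ (e 0)) (e 1) := ⟨_, rfl⟩
  obtain ⟨p₂, hp₂⟩ : ∃ p, p = inner ℝ (Ψ (e 0)) (e 2) := ⟨_, rfl⟩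
  obtain ⟨p₃, hp₃⟩ : ∃ p, p = inner ℝ (Ψ (e 0)) (e 3) := ⟨_, rfl⟩
  -- For fixed `Ψ` and `c`, these are 18 linear equations in the 16 entries `b i j` of `L`.
  have eqs := commutator_identity_frame he hΨ hasd hR hRasd h hb
    (fun i j ↦ (inner_frame e i j).symm) hp₁ hp₂ hp₃
  obtain ⟨s01, t01, r01⟩ := eqs 0 1
  obtain ⟨s02, t02, r02⟩ := eqs 0 2
  obtain ⟨s03, t03, r03⟩ := eqs 0 3
  obtain ⟨s12, t12, r12⟩ := eqs 1 2
  obtain ⟨s13, t13, r13⟩ := eqs 1 3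
  obtain ⟨s23, t23, r23⟩ := eqs 2 3
  clear eqs
  simp at s01 t01 r01 s02 t02 r02 s03 t03 r03 s12 t12 r12 s13 t13 r13 s23 t23 r23
  have skew (i j : Fin 4) : b i j + b j i = 0 := by
    fin_cases i <;> fin_cases j <;> simp only [Fin.zero_eta, Fin.mk_one, Fin.reduceFinMk] <;>
      linarith only [s01, t01, r01, s02, t02, r02, s03, t03, r03, s12, t12, r12, s13, t13, r13,
        s23, t23, r23]
  have e₁ : b 0 1 - b 2 3 = 2 * c * p₁ := by
    linarith only [t03, r02, t12, r13, skew 0 1, skew 2 3]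
  have e₂ : b 0 2 + b 1 3 = 2 * c * p₂ := by
    linarith only [s03, r01, s12, r23, skew 0 2, skew 1 3]
  have e₃ : b 0 3 - b 1 2 = 2 * c * p₃ := by
    linarith only [s02, t01, s13, t23, skew 0 3, skew 1 2]
  have hL : IsSkew L := isSkew_of_orthonormalBasis e L fun i j ↦ by rw [← hb, ← hb, skew]
  refine ⟨hL, ?_⟩
  obtain ⟨k₁, k₂, k₃, k₄, k₅, k₆⟩ := asdPart_frame he hL
  simp only [← hb] at k₁ k₂ k₃ k₄ k₅ k₆
  refine IsSkew.ext_frame e (isSkew_asdPart o hL) (hΨ.smul c) ?_ ?_ ?_ ?_ ?_ ?_ <;>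
    simp only [Pi.smul_apply, real_inner_smul_left]
  · rw [k₁, ← hp₁]; linarith only [e₁]
  · rw [k₂, ← hp₂]; linarith only [e₂]
  · rw [k₃, ← hp₃]; linarith only [e₃]
  · rw [k₄, ← q₃, ← hp₃]; linarith only [e₃]
  · rw [k₅, show inner ℝ (Ψ (e 1)) (e 3) = p₂ by linarith only [q₂, hp₂]]; linarith only [e₂]
  · rw [k₆, ← q₁, ← hp₁]; linarith only [e₁]

end HodgeStar

/-! ### Derivatives of skew endomorphism fields -/

section HomBundle
variable {E : Type*} [NormedAddCommGroup E] [NormedSpace ℝ E] [FiniteDimensional ℝ E]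
  {H : Type*} [TopologicalSpace H] {I : ModelWithCorners ℝ E H}
  {M : Type*} [TopologicalSpace M] [ChartedSpace H M] [IsManifold I ∞ M]
  {F : Type*} [NormedAddCommGroup F] [NormedSpace ℝ F]
  {V : M → Type*} [TopologicalSpace (TotalSpace F V)] [∀ x, AddCommGroup (V x)]
  [∀ x, Module ℝ (V x)] [∀ x, TopologicalSpace (V x)] [FiberBundle F V] [VectorBundle ℝ F V]
  [∀ x, IsTopologicalAddGroup (V x)] [∀ x, ContinuousSMul ℝ (V x)]
  [ContMDiffVectorBundle ∞ F V I]

/-- A section of `Hom(TM, V)` is smooth if it takes smooth vector fields to smooth sections. -/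
theorem contMDiffAt_hom_section {A : Π x : M, TangentSpace I x →L[ℝ] V x} {x : M}
    (hA : ∀ Y : Π x : M, TangentSpace I x, CMDiffAt ∞ (T% Y) x →
      CMDiffAt ∞ (T% fun y ↦ A y (Y y)) x) :
    ContMDiffAt I (I.prod 𝓘(ℝ, E →L[ℝ] F)) ∞
      (fun y ↦ (⟨y, A y⟩ : TotalSpace (E →L[ℝ] F) fun x : M ↦ TangentSpace I x →L[ℝ] V x)) x := by
  rw [contMDiffAt_hom_bundle]
  refine ⟨contMDiffAt_id, ?_⟩
  let b := finBasis ℝ E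
  have decomp (L : E →L[ℝ] F) : L = ∑ i, (b.coord i).toContinuousLinearMap.smulRight (L (b i)) := by
    ext v
    simp only [sum_apply, ContinuousLinearMap.smulRight_apply, LinearMap.coe_toContinuousLinearMap',
      Basis.coord_apply]
    conv_lhs => rw [← b.sum_repr v, map_sum]
    simp only [map_smul]
  set t := trivializationAt E (TangentSpace I : M → Type _) x
  set t' := trivializationAt F V x
  have hx : x ∈ t.baseSet := mem_baseSet_trivializationAt ..
  have hx' : x ∈ t'.baseSet := mem_baseSet_trivializationAt ..
  have key (w : E) : CMDiffAt ∞ (fun y ↦ ContinuousLinearMap.inCoordinates E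
      (TangentSpace I : M → Type _) F V x y x y (A y) w) x := by
    have h := hA (extend E (t.symm x w)) (contMDiffAt_extend ..)
    rw [contMDiffAt_section] at h
    refine h.congr_of_eventuallyEq ?_
    filter_upwards [t.open_baseSet.mem_nhds hx, t'.open_baseSet.mem_nhds hx'] with y hy hy'
    rw [ContinuousLinearMap.inCoordinates_eq hy hy']
    have e : (t ⟨x, t.symm x w⟩).2 = w := by rw [t.apply_mk_symm hx]
    simp [extend]
    change (t' ⟨y, A y (t.symm y w)⟩).2 = (t' ⟨y, A y (t.symm y (t ⟨x, t.symm x w⟩).2)⟩).2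
    rw [e]
  have : (fun y ↦ ContinuousLinearMap.inCoordinates E (TangentSpace I : M → Type _) F V x y x y
      (A y)) = fun y ↦ ∑ i, ContinuousLinearMap.smulRightL ℝ E F (b.coord i).toContinuousLinearMap
        (ContinuousLinearMap.inCoordinates E (TangentSpace I : M → Type _) F V x y x y (A y)
          (b i)) := by
    ext1 y
    exact decomp _
  change CMDiffAt ∞ (fun y ↦ ContinuousLinearMap.inCoordinates E (TangentSpace I : M → Type _)
    F V x y x y (A y)) x
  rw [this]
  exact ContMDiffAt.sum fun i _ ↦ ContMDiffAt.comp x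
    (ContinuousLinearMap.contMDiff (ContinuousLinearMap.smulRightL ℝ E F
      (b.coord i).toContinuousLinearMap)).contMDiffAt (key (b i))

end HomBundle

section EndomorphismFields
variable {E : Type*} [NormedAddCommGroup E] [NormedSpace ℝ E] [FiniteDimensional ℝ E]
  {H : Type*} [TopologicalSpace H] {I : ModelWithCorners ℝ E H}
  {M : Type*} [TopologicalSpace M] [ChartedSpace H M] [IsManifold I ∞ M]
  [RiemannianBundle (fun x : M ↦ TangentSpace I x)]
  [IsContMDiffRiemannianBundle I ∞ E (fun x : M ↦ TangentSpace I x)]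

/-- A field of endomorphisms of the tangent spaces is smooth at `x` if it takes vector fields
smooth at `x` to vector fields smooth at `x`. -/
def IsSmoothEndAt (A : Π y : M, TangentSpace I y →L[ℝ] TangentSpace I y) (x : M) : Prop :=
  ∀ Y : Π y : M, TangentSpace I y, CMDiffAt ∞ (T% Y) x → CMDiffAt ∞ (T% fun y ↦ A y (Y y)) x

variable {A : Π y : M, TangentSpace I y →L[ℝ] TangentSpace I y} {x : M}

/-- The derivative of the function `g(AY, Z) + g(Y, AZ) = 0`. -/
theorem inner_covDeriv_skew (hs : ∀ y, IsSkew (A y)) {Y Z : Π y : M, TangentSpace I y}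
    (hY : MDiffAt (T% Y) x) (hAY : MDiffAt (T% fun y ↦ A y (Y y)) x)
    (hZ : MDiffAt (T% Z) x) (hAZ : MDiffAt (T% fun y ↦ A y (Z y)) x) (u : TangentSpace I x) :
    inner ℝ (leviCivita I M (fun y ↦ A y (Y y)) x u - A x (leviCivita I M Y x u)) (Z x) +
      inner ℝ (Y x) (leviCivita I M (fun y ↦ A y (Z y)) x u - A x (leviCivita I M Z x u)) = 0 := by
  have h0 : metricFun (fun y ↦ A y (Y y)) Z + metricFun Y (fun y ↦ A y (Z y)) = 0 := by
    ext y
    exact hs y _ _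
  have h1 := mvfderiv_metricFun hAY hZ u
  have h2 := mvfderiv_metricFun hY hAZ u
  have h3 := mvfderiv_add (mdiff_metricFun hAY hZ) (mdiff_metricFun hY hAZ)
  rw [h0, mvfderiv_zero] at h3
  have h4 := congrArg (fun L ↦ L u) h3
  simp only [zero_apply, add_apply, h1, h2] at h4
  have h5 := hs x (leviCivita I M Y x u) (Z x)
  have h6 := hs x (Y x) (leviCivita I M Z x u)
  simp only [inner_sub_left, inner_sub_right]
  linarith

theorem isSkew_covDerivEnd (hA : IsSmoothEndAt A x) (hs : ∀ y, IsSkew (A y))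
    (u : TangentSpace I x) : IsSkew (covDerivEnd A x u) := by
  intro v w
  have hv : CMDiffAt ∞ (T% (extend E v : Π y : M, TangentSpace I y)) x := contMDiffAt_extend ..
  have hw : CMDiffAt ∞ (T% (extend E w : Π y : M, TangentSpace I y)) x := contMDiffAt_extend ..
  have := inner_covDeriv_skew hs (hv.mdifferentiableAt (by simp))
    ((hA _ hv).mdifferentiableAt (by simp)) (hw.mdifferentiableAt (by simp))
    ((hA _ hw).mdifferentiableAt (by simp)) u
  simpa [covDerivEnd] using this

/-- The Leibniz rule `D_u (AY) = (D_u A) Y + A (D_u Y)`; for skew `A` the tensoriality of `D_u A`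
follows from its skewness. -/
theorem leviCivita_end_apply (hA : IsSmoothEndAt A x) (hs : ∀ y, IsSkew (A y))
    {Y : Π y : M, TangentSpace I y} (hY : MDiffAt (T% Y) x)
    (hAY : MDiffAt (T% fun y ↦ A y (Y y)) x) (u : TangentSpace I x) :
    leviCivita I M (fun y ↦ A y (Y y)) x u =
      covDerivEnd A x u (Y x) + A x (leviCivita I M Y x u) := by
  rw [← sub_eq_iff_eq_add]
  refine ext_inner_right ℝ fun w ↦ ?_
  have hw : CMDiffAt ∞ (T% (extend E w : Π y : M, TangentSpace I y)) x := contMDiffAt_extend ..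
  have h1 := inner_covDeriv_skew hs hY hAY (hw.mdifferentiableAt (by simp))
    ((hA _ hw).mdifferentiableAt (by simp)) u
  have h2 := isSkew_covDerivEnd hA hs u (Y x) w
  simp only [extend_apply_self] at h1
  simp only [covDerivEnd] at h2 ⊢
  linarith

/-- The second covariant derivative of a Killing field `K` is given by the curvature,
`D²_{u,v} K = R(u, K) v`. The difference `D²_{u,v} K - D²_{v,u} K` is `R(u, v) K`, and
`g(D²_{u,v} K, w)` is skew in `v` and `w`, as in the derivation of the Koszul formula. -/
theorem covDerivEnd_leviCivita_of_killing {K : Π y : M, TangentSpace I y}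
    (hK : CMDiffAt ∞ (T% K) x) (hs : ∀ y, IsSkew (leviCivita I M K y)) (u v : TangentSpace I x) :
    covDerivEnd (leviCivita I M K) x u v = curvature x u (K x) v := by
  have hA : IsSmoothEndAt (leviCivita I M K) x := fun Y hY ↦ contMDiffAt_leviCivita hY hK
  have alt (u v : TangentSpace I x) : covDerivEnd (leviCivita I M K) x u v -
      covDerivEnd (leviCivita I M K) x v u = curvature x u v (K x) := by
    have hu : CMDiffAt ∞ (T% (extend E u : Π y : M, TangentSpace I y)) x := contMDiffAt_extend ..
    have hv : CMDiffAt ∞ (T% (extend E v : Π y : M, TangentSpace I y)) x := contMDiffAt_extend ..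
    have h1 := curvatureField_eq hu hv hK
    have h2 := leviCivita_sub_leviCivita (hu.mdifferentiableAt (by simp))
      (hv.mdifferentiableAt (by simp))
    simp only [extend_apply_self] at h1 h2
    rw [← h1, curvatureField, ← h2]
    simp only [covDerivEnd, map_sub, extend_apply_self]
    abel
  have skew (u v w : TangentSpace I x) := (isSkew_covDerivEnd hA hs u).inner_swap v w
  have alt' (u v w : TangentSpace I x) : inner ℝ (covDerivEnd (leviCivita I M K) x u v) w -
      inner ℝ (covDerivEnd (leviCivita I M K) x v u) w = inner ℝ (curvature x u v (K x)) w := by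
    rw [← inner_sub_left, alt]
  refine ext_inner_right ℝ fun w ↦ ?_
  have b : inner ℝ (curvature x u v w + curvature x v w u + curvature x w u v) (K x) = 0 := by
    rw [curvature_bianchi, inner_zero_left]
  simp only [inner_add_left] at b
  have s (u v w : TangentSpace I x) := inner_curvature_skew u v w (K x)
  simp only [real_inner_comm (curvature x _ _ (K x))] at s
  have p := inner_curvature_pair u (K x) v w
  have h1 := alt' u v w
  have h2 := alt' v w u
  have h3 := alt' w u v
  have h4 := skew u v w
  have h5 := skew v u w
  have h6 := skew w u v
  have h7 := s u v w
  have h8 := s v w u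
  have h9 := s w u v
  linarith

theorem isSmoothEndAt_wedgeHom {G U : Π y : M, TangentSpace I y} (hG : CMDiffAt ∞ (T% G) x)
    (hU : CMDiffAt ∞ (T% U) x) : IsSmoothEndAt (fun y ↦ wedgeHom (G y) (U y)) x := by
  intro Y hY
  have h := ((contMDiffAt_metricFun hG hY).smul_section hU).sub_section
    ((contMDiffAt_metricFun hU hY).smul_section hG)
  refine h.congr_of_eventuallyEq (Filter.Eventually.of_forall fun y ↦ ?_)
  simp only [wedgeHom_apply]
  rfl

theorem covDerivEnd_wedgeHom {G U : Π y : M, TangentSpace I y} (hG : CMDiffAt ∞ (T% G) x)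
    (hU : CMDiffAt ∞ (T% U) x) (u w : TangentSpace I x) :
    covDerivEnd (fun y ↦ wedgeHom (G y) (U y)) x u w =
      wedgeHom (leviCivita I M G x u) (U x) w + wedgeHom (G x) (leviCivita I M U x u) w := by
  set W : Π y : M, TangentSpace I y := extend E w
  have hW : CMDiffAt ∞ (T% W) x := contMDiffAt_extend ..
  have e : (fun y ↦ wedgeHom (G y) (U y) (W y)) = metricFun G W • U - metricFun U W • G := by
    ext y
    rw [wedgeHom_apply]
    rfl
  have hG' := hG.mdifferentiableAt (n := ∞) (by simp)
  have hU' := hU.mdifferentiableAt (n := ∞) (by simp)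
  have hW' := hW.mdifferentiableAt (n := ∞) (by simp)
  have hGW := mdiff_metricFun hG' hW'
  have hUW := mdiff_metricFun hU' hW'
  have : leviCivita I M (fun y ↦ wedgeHom (G y) (U y) (W y)) x u =
      leviCivita I M (metricFun G W • U - metricFun U W • G) x u := by rw [e]
  rw [covDerivEnd, this, leviCivita_sub (hGW.smul_section hU') (hUW.smul_section hG'),
    leviCivita_smul hGW hU', leviCivita_smul hUW hG', mvfderiv_metricFun hG' hW',
    mvfderiv_metricFun hU' hW']
  simp only [wedgeHom_apply, metricFun, W, extend_apply_self]
  module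

/-- The Ricci identity for the second covariant derivatives of a skew endomorphism field `Ψ`. -/
theorem curvature_commutator {Ψ : Π y : M, TangentSpace I y →L[ℝ] TangentSpace I y}
    (hΨ : ∀ y, IsSmoothEndAt Ψ y) (hs : ∀ y, IsSkew (Ψ y)) {U V W : Π y : M, TangentSpace I y}
    (hU : CMDiffAt ∞ (T% U) x) (hV : CMDiffAt ∞ (T% V) x) (hW : CMDiffAt ∞ (T% W) x) :
    curvature x (U x) (V x) (Ψ x (W x)) - Ψ x (curvature x (U x) (V x) (W x)) =
      leviCivita I M (fun y ↦ covDerivEnd Ψ y (V y) (W y)) x (U x)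
      - covDerivEnd Ψ x (V x) (leviCivita I M W x (U x))
      - (leviCivita I M (fun y ↦ covDerivEnd Ψ y (U y) (W y)) x (V x)
      - covDerivEnd Ψ x (U x) (leviCivita I M W x (V x)))
      - covDerivEnd Ψ x (mlieBracket I U V x) (W x) := by
  have hΨW := hΨ x W hW
  have first : ∀ {V : Π y : M, TangentSpace I y}, ∀ᶠ y in 𝓝 x,
      leviCivita I M (fun z ↦ Ψ z (W z)) y (V y) =
        covDerivEnd Ψ y (V y) (W y) + Ψ y (leviCivita I M W y (V y)) := by
    intro V
    filter_upwards [eventually_mdiffAt hW, eventually_mdiffAt hΨW] with y hWy hΨWy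
    exact leviCivita_end_apply (hΨ y) hs hWy hΨWy (V y)
  have second : ∀ {U V : Π y : M, TangentSpace I y}, CMDiffAt ∞ (T% U) x → CMDiffAt ∞ (T% V) x →
      leviCivita I M (fun y ↦ leviCivita I M (fun z ↦ Ψ z (W z)) y (V y)) x (U x) =
      leviCivita I M (fun y ↦ covDerivEnd Ψ y (V y) (W y)) x (U x)
      + covDerivEnd Ψ x (U x) (leviCivita I M W x (V x))
      + Ψ x (leviCivita I M (fun y ↦ leviCivita I M W y (V y)) x (U x)) := by
    intro U V hU hV
    have h1 := contMDiffAt_leviCivita hV hΨW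
    have hVW := contMDiffAt_leviCivita hV hW
    have h2 := hΨ x _ hVW
    have h3 : CMDiffAt ∞ (T% fun y ↦ covDerivEnd Ψ y (V y) (W y)) x := by
      refine (h1.sub_section h2).congr_of_eventuallyEq ?_
      filter_upwards [first (V := V)] with y hy
      simp [hy]
    have h3' := h3.mdifferentiableAt (n := ∞) (by simp)
    have h2' := h2.mdifferentiableAt (n := ∞) (by simp)
    rw [leviCivita_congr (h1.mdifferentiableAt (by simp)) (mdifferentiableAt_add_section h3' h2')
      (first (V := V)), leviCivita_add h3' h2',
      leviCivita_end_apply (hΨ x) hs (hVW.mdifferentiableAt (by simp)) h2']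
    abel
  rw [← curvatureField_eq hU hV hW]
  have := curvatureField_eq hU hV hΨW
  rw [← this]
  simp only [curvatureField]
  rw [second hU hV, second hV hU, (first (V := mlieBracket I U V)).self_of_nhds]
  simp only [map_sub]
  abel

end EndomorphismFields

/-! ### The Hodge star is parallel -/

theorem inner_gramSchmidt_self {V ι : Type*} [NormedAddCommGroup V]
    [InnerProductSpace ℝ V] [LinearOrder ι] [LocallyFiniteOrderBot ι] [WellFoundedLT ι]
    (f : ι → V) (i : ι) : inner ℝ (InnerProductSpace.gramSchmidt ℝ f i) (f i) =
      inner ℝ (InnerProductSpace.gramSchmidt ℝ f i) (InnerProductSpace.gramSchmidt ℝ f i) := by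
  conv_lhs => rw [InnerProductSpace.gramSchmidt_def'' ℝ f i]
  rw [inner_add_right, inner_sum, add_eq_left]
  refine Finset.sum_eq_zero fun j hj ↦ ?_
  rw [real_inner_smul_right, InnerProductSpace.gramSchmidt_orthogonal ℝ f
    (Finset.mem_Iio.mp hj).ne', mul_zero]

/-- The Gram-Schmidt process preserves the orientation of a basis. -/
theorem exists_orthonormalBasis_gramSchmidtNormed {V ι : Type*} [NormedAddCommGroup V]
    [InnerProductSpace ℝ V] [LinearOrder ι] [LocallyFiniteOrderBot ι] [WellFoundedLT ι]
    [Fintype ι] (f : Basis ι ℝ V) : ∃ b : OrthonormalBasis ι ℝ V,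
      (∀ i, b i = InnerProductSpace.gramSchmidtNormed ℝ f i) ∧
      b.toBasis.orientation = f.orientation := by
  have := f.finiteDimensional_of_finite
  have hc : finrank ℝ V = Fintype.card ι := finrank_eq_card_basis f
  have happ (i : ι) : InnerProductSpace.gramSchmidtOrthonormalBasis hc f i =
      InnerProductSpace.gramSchmidtNormed ℝ f i := by
    refine InnerProductSpace.gramSchmidtOrthonormalBasis_apply hc fun h0 ↦ ?_
    have := InnerProductSpace.gramSchmidtNormed_unit_length i f.linearIndependent
    simp [h0] at this
  refine ⟨InnerProductSpace.gramSchmidtOrthonormalBasis hc f, happ, ?_⟩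
  rw [Basis.orientation_eq_iff_det_pos, InnerProductSpace.gramSchmidtOrthonormalBasis_det]
  refine Finset.prod_pos fun i _ ↦ ?_
  have h0 : 0 < ‖InnerProductSpace.gramSchmidt ℝ f i‖ :=
    norm_pos_iff.mpr (InnerProductSpace.gramSchmidt_ne_zero i f.linearIndependent)
  rw [happ, InnerProductSpace.gramSchmidtNormed, real_inner_smul_left,
    inner_gramSchmidt_self, real_inner_self_eq_norm_sq]
  simp only [RCLike.ofReal_real_eq_id, id_eq]
  positivity

section FourManifolds
variable {M : Type*} [TopologicalSpace M] [ChartedSpace (EuclideanSpace ℝ (Fin 4)) M]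
  [IsManifold (𝓡 4) ∞ M]
  [RiemannianBundle (fun x : M ↦ TangentSpace (𝓡 4) x)]
  [IsContMDiffRiemannianBundle (𝓡 4) ∞ (EuclideanSpace ℝ (Fin 4))
    (fun x : M ↦ TangentSpace (𝓡 4) x)]

/-- The vector field `X` is smooth at `x`. -/
abbrev SmoothFieldAt (X : Π y : M, TangentSpace (𝓡 4) y) (x : M) : Prop :=
  ContMDiffAt (𝓡 4) (𝓡 4).tangent ∞
    (fun y ↦ (⟨y, X y⟩ :
      TotalSpace (EuclideanSpace ℝ (Fin 4)) (TangentSpace (𝓡 4) : M → Type _))) x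

/-- The frame is oriented at all points near `x`: it is obtained by applying the Gram-Schmidt process
to vector fields with constant coefficients in a trivialization, in which the orientation is locally
constant. -/
theorem exists_oriented_orthonormal_frame (o : ManifoldOrientation M) (x : M) :
    ∃ e : Fin 4 → Π y : M, TangentSpace (𝓡 4) y, (∀ i, SmoothFieldAt (e i) x) ∧
      ∀ᶠ y in 𝓝 x, ∃ b : OrthonormalBasis (Fin 4) ℝ (TangentSpace (𝓡 4) y),
        (∀ i, b i = e i y) ∧ b.toBasis.orientation = o.toFun y := by
  obtain ⟨b, hb⟩ := exists_oriented_orthonormalBasis (o.toFun x)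
  have hli : LinearIndependent ℝ fun i ↦
      (extend (EuclideanSpace ℝ (Fin 4)) (b i) x : TangentSpace (𝓡 4) x) := by
    simpa using b.toBasis.linearIndependent
  refine ⟨fun i y ↦ InnerProductSpace.gramSchmidtNormed ℝ
    (fun j ↦ extend (EuclideanSpace ℝ (Fin 4)) (b j) y) i,
    fun i ↦ contMDiffAt_gramSchmidtNormed (b := fun j ↦ extend (EuclideanSpace ℝ (Fin 4)) (b j))
      (fun j ↦ contMDiffAt_extend ..) hli i, ?_⟩
  set t := trivializationAt (EuclideanSpace ℝ (Fin 4)) (TangentSpace (𝓡 4) : M → Type _) x with ht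
  have hx : x ∈ t.baseSet := mem_baseSet_trivializationAt ..
  filter_upwards [t.open_baseSet.mem_nhds hx, o.locallyConstant x] with y hy hoy
  let f : Basis (Fin 4) ℝ (TangentSpace (𝓡 4) y) :=
    (b.toBasis.map (t.linearEquivAt ℝ x hx)).map (t.linearEquivAt ℝ y hy).symm
  have hf (i) : f i = extend (EuclideanSpace ℝ (Fin 4)) (b i) y := by
    simp [f, extend, ht]
  have hfo : f.orientation = o.toFun y := by
    apply (Orientation.map (Fin 4) (t.linearEquivAt ℝ y hy)).injective
    rw [hoy hy, Basis.orientation_map, Basis.orientation_map, hb]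
    exact (Orientation.map (Fin 4) (t.linearEquivAt ℝ y hy)).apply_symm_apply _
  obtain ⟨g, hg, hgo⟩ := exists_orthonormalBasis_gramSchmidtNormed f
  refine ⟨g, fun i ↦ ?_, hgo.trans hfo⟩
  rw [hg]
  congr 1

variable {o : ManifoldOrientation M}
  {A : Π y : M, TangentSpace (𝓡 4) y →L[ℝ] TangentSpace (𝓡 4) y} {x : M}

/-- The field of antiselfdual parts of a field of skew endomorphisms. Skewness is used in the
encoding: it makes the value of `asdPart` a linear map. -/
def asdField (o : ManifoldOrientation M)
    (A : Π y : M, TangentSpace (𝓡 4) y →L[ℝ] TangentSpace (𝓡 4) y)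
    (hs : ∀ y, IsSkew (A y)) (y : M) :
    TangentSpace (𝓡 4) y →L[ℝ] TangentSpace (𝓡 4) y :=
  asdHom (o.toFun y) (A y) (hs y)

theorem isSkew_asdField (hs : ∀ y, IsSkew (A y)) (y : M) : IsSkew (asdField o A hs y) :=
  isSkew_asdPart (o.toFun y) (hs y)

/-- `y ↦ g(A e_i, e_j)`, the matrix entries of an endomorphism field in a frame. -/
def entry (A : Π y : M, TangentSpace (𝓡 4) y →L[ℝ] TangentSpace (𝓡 4) y)
    (e : Fin 4 → Π y : M, TangentSpace (𝓡 4) y) (i j : Fin 4) : M → ℝ :=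
  metricFun (fun y ↦ A y (e i y)) (e j)

/-- In an oriented orthonormal frame, `A ↦ A⁻` acts on the matrix entries with constant
coefficients. -/
theorem entry_asdField (hs : ∀ y, IsSkew (A y)) {e : Fin 4 → Π y : M, TangentSpace (𝓡 4) y} {y : M}
    (he : ∃ b : OrthonormalBasis (Fin 4) ℝ (TangentSpace (𝓡 4) y),
      (∀ i, b i = e i y) ∧ b.toBasis.orientation = o.toFun y) :
    entry (asdField o A hs) e 0 1 y = 2⁻¹ * (entry A e 0 1 y - entry A e 2 3 y) ∧
    entry (asdField o A hs) e 0 2 y = 2⁻¹ * (entry A e 0 2 y + entry A e 1 3 y) ∧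
    entry (asdField o A hs) e 0 3 y = 2⁻¹ * (entry A e 0 3 y - entry A e 1 2 y) ∧
    entry (asdField o A hs) e 1 2 y = 2⁻¹ * (entry A e 1 2 y - entry A e 0 3 y) ∧
    entry (asdField o A hs) e 1 3 y = 2⁻¹ * (entry A e 1 3 y + entry A e 0 2 y) ∧
    entry (asdField o A hs) e 2 3 y = 2⁻¹ * (entry A e 2 3 y - entry A e 0 1 y) := by
  obtain ⟨b, hb, hbo⟩ := he
  have := asdPart_frame hbo (hs y)
  simp only [hb] at this
  exact this

theorem entry_swap (hs : ∀ y, IsSkew (A y)) (e : Fin 4 → Π y : M, TangentSpace (𝓡 4) y)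
    (i j : Fin 4) : entry A e i j = - entry A e j i := by
  ext y
  exact (hs y).inner_swap _ _

theorem contMDiffAt_entry (hA : IsSmoothEndAt A x) {e : Fin 4 → Π y : M, TangentSpace (𝓡 4) y}
    (he : ∀ i, SmoothFieldAt (e i) x) (i j : Fin 4) :
    ContMDiffAt (𝓡 4) 𝓘(ℝ, ℝ) ∞ (entry A e i j) x :=
  contMDiffAt_metricFun (hA _ (he i)) (he j)

theorem contMDiffAt_entry_asdField (hA : IsSmoothEndAt A x) (hs : ∀ y, IsSkew (A y))
    {e : Fin 4 → Π y : M, TangentSpace (𝓡 4) y} (he : ∀ i, SmoothFieldAt (e i) x)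
    (ho : ∀ᶠ y in 𝓝 x, ∃ b : OrthonormalBasis (Fin 4) ℝ (TangentSpace (𝓡 4) y),
      (∀ i, b i = e i y) ∧ b.toBasis.orientation = o.toFun y) (i j : Fin 4) :
    ContMDiffAt (𝓡 4) 𝓘(ℝ, ℝ) ∞ (entry (asdField o A hs) e i j) x := by
  have hc (i j) := contMDiffAt_entry hA he i j
  have c : ContMDiffAt (𝓡 4) 𝓘(ℝ, ℝ) ∞ (fun _ : M ↦ (2⁻¹ : ℝ)) x := contMDiffAt_const
  have s (i j) := entry_swap (isSkew_asdField (o := o) hs) e i j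
  have h01 : ContMDiffAt (𝓡 4) 𝓘(ℝ, ℝ) ∞ (entry (asdField o A hs) e 0 1) x :=
    (c.mul ((hc 0 1).sub (hc 2 3))).congr_of_eventuallyEq
      (ho.mono fun y hy ↦ (entry_asdField hs hy).1)
  have h02 : ContMDiffAt (𝓡 4) 𝓘(ℝ, ℝ) ∞ (entry (asdField o A hs) e 0 2) x :=
    (c.mul ((hc 0 2).add (hc 1 3))).congr_of_eventuallyEq
      (ho.mono fun y hy ↦ (entry_asdField hs hy).2.1)
  have h03 : ContMDiffAt (𝓡 4) 𝓘(ℝ, ℝ) ∞ (entry (asdField o A hs) e 0 3) x :=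
    (c.mul ((hc 0 3).sub (hc 1 2))).congr_of_eventuallyEq
      (ho.mono fun y hy ↦ (entry_asdField hs hy).2.2.1)
  have h12 : ContMDiffAt (𝓡 4) 𝓘(ℝ, ℝ) ∞ (entry (asdField o A hs) e 1 2) x :=
    (c.mul ((hc 1 2).sub (hc 0 3))).congr_of_eventuallyEq
      (ho.mono fun y hy ↦ (entry_asdField hs hy).2.2.2.1)
  have h13 : ContMDiffAt (𝓡 4) 𝓘(ℝ, ℝ) ∞ (entry (asdField o A hs) e 1 3) x :=
    (c.mul ((hc 1 3).add (hc 0 2))).congr_of_eventuallyEq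
      (ho.mono fun y hy ↦ (entry_asdField hs hy).2.2.2.2.1)
  have h23 : ContMDiffAt (𝓡 4) 𝓘(ℝ, ℝ) ∞ (entry (asdField o A hs) e 2 3) x :=
    (c.mul ((hc 2 3).sub (hc 0 1))).congr_of_eventuallyEq
      (ho.mono fun y hy ↦ (entry_asdField hs hy).2.2.2.2.2)
  have h0 (i) : ContMDiffAt (𝓡 4) 𝓘(ℝ, ℝ) ∞ (entry (asdField o A hs) e i i) x := by
    have : entry (asdField o A hs) e i i = fun _ ↦ 0 := by
      ext y
      have := congrFun (s i i) y
      simp only [Pi.neg_apply] at this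
      linarith
    rw [this]
    exact contMDiffAt_const
  have neg {i j} (h : ContMDiffAt (𝓡 4) 𝓘(ℝ, ℝ) ∞ (entry (asdField o A hs) e i j) x) :
      ContMDiffAt (𝓡 4) 𝓘(ℝ, ℝ) ∞ (entry (asdField o A hs) e j i) x := by
    rw [s]
    exact h.neg
  fin_cases i <;> fin_cases j <;>
    first
    | exact h0 _
    | assumption
    | exact neg (by assumption)

/-- The antiselfdual part of a smooth skew endomorphism field is smooth, because its entries in a
smooth oriented orthonormal frame are. -/
theorem isSmoothEndAt_asdField (hA : IsSmoothEndAt A x) (hs : ∀ y, IsSkew (A y)) :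
    IsSmoothEndAt (asdField o A hs) x := by
  obtain ⟨e, he, ho⟩ := exists_oriented_orthonormal_frame o x
  intro Y hY
  have hsum : SmoothFieldAt (fun y ↦ ∑ i, ∑ j,
      (metricFun Y (e i) * entry (asdField o A hs) e i j) y • e j y) x :=
    ContMDiffAt.sum_section fun i _ ↦ ContMDiffAt.sum_section fun j _ ↦
      ((contMDiffAt_metricFun hY (he i)).mul
        (contMDiffAt_entry_asdField hA hs he ho i j)).smul_section (he j)
  refine hsum.congr_of_eventuallyEq ?_
  filter_upwards [ho] with y ⟨b, hb, _⟩
  have h1 : asdField o A hs y (Y y) = ∑ i, ∑ j,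
      (metricFun Y (e i) * entry (asdField o A hs) e i j) y • e j y := by
    conv_lhs => rw [← b.sum_repr' (Y y), map_sum]
    refine Finset.sum_congr rfl fun i _ ↦ ?_
    rw [map_smul, ← b.sum_repr' (asdField o A hs y (b i)), Finset.smul_sum]
    refine Finset.sum_congr rfl fun j _ ↦ ?_
    simp only [Pi.mul_apply, mul_smul, entry, metricFun, hb, real_inner_comm]
  rw [h1]

/-- The entries of `D_u A` in an orthonormal frame, with the connection coefficients
`θ i j = g(D_u e_i, e_j)`. -/
theorem inner_covDerivEnd_frame (hA : IsSmoothEndAt A x) (hs : ∀ y, IsSkew (A y))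
    {e : Fin 4 → Π y : M, TangentSpace (𝓡 4) y} (he : ∀ i, SmoothFieldAt (e i) x)
    {b : OrthonormalBasis (Fin 4) ℝ (TangentSpace (𝓡 4) x)} (hb : ∀ i, b i = e i x)
    (u : TangentSpace (𝓡 4) x) {θ : Fin 4 → Fin 4 → ℝ}
    (hθ : ∀ i j, θ i j = inner ℝ (leviCivita (𝓡 4) M (e i) x u) (e j x)) (i j : Fin 4) :
    inner ℝ (covDerivEnd A x u (b i)) (b j) = mvfderiv (𝓡 4) (entry A e i j) x u +
      ∑ m, (θ j m * entry A e m i x - θ i m * entry A e m j x) := by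
  have expand (i j : Fin 4) : inner ℝ (A x (leviCivita (𝓡 4) M (e i) x u)) (e j x) =
      ∑ m, θ i m * entry A e m j x := by
    conv_lhs => rw [← b.sum_repr' (leviCivita (𝓡 4) M (e i) x u), map_sum, sum_inner]
    refine Finset.sum_congr rfl fun m _ ↦ ?_
    rw [map_smul, real_inner_smul_left, hθ, hb, real_inner_comm]
    rfl
  have hei := ContMDiffAt.mdifferentiableAt (he i) (n := ∞) (by simp)
  have hej := ContMDiffAt.mdifferentiableAt (he j) (n := ∞) (by simp)
  have hAei := ContMDiffAt.mdifferentiableAt (hA _ (he i)) (n := ∞) (by simp)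
  have h1 := leviCivita_end_apply hA hs hei hAei u
  have h2 := mvfderiv_metricFun hAei hej u
  have h3 := hs x (e i x) (leviCivita (𝓡 4) M (e j) x u)
  have h4 := expand i j
  have h5 := expand j i
  rw [Finset.sum_sub_distrib, ← h4, ← h5,
    show entry A e i j = metricFun (fun y ↦ A y (e i y)) (e j) from rfl, h2, h1, inner_add_left,
    hb, hb, real_inner_comm (e i x)]
  linarith

theorem mvfderiv_half_sub {f g : M → ℝ} {x : M}
    (hf : MDifferentiableAt (𝓡 4) 𝓘(ℝ, ℝ) f x) (hg : MDifferentiableAt (𝓡 4) 𝓘(ℝ, ℝ) g x)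
    (u : TangentSpace (𝓡 4) x) :
    mvfderiv (𝓡 4) (fun y ↦ 2⁻¹ * (f y - g y)) x u =
      2⁻¹ * (mvfderiv (𝓡 4) f x u - mvfderiv (𝓡 4) g x u) := by
  have h := mvfderiv_mul (mdifferentiableAt_const (c := (2⁻¹ : ℝ))) (hf.sub hg)
  have h' := congrArg (fun L ↦ L u) h
  rw [mvfderiv_sub hf hg, mvfderiv_const] at h'
  simp only [smul_apply, add_apply, sub_apply, smul_eq_mul, zero_apply, mul_zero, add_zero] at h'
  exact h'

theorem mvfderiv_half_add {f g : M → ℝ} {x : M}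
    (hf : MDifferentiableAt (𝓡 4) 𝓘(ℝ, ℝ) f x) (hg : MDifferentiableAt (𝓡 4) 𝓘(ℝ, ℝ) g x)
    (u : TangentSpace (𝓡 4) x) :
    mvfderiv (𝓡 4) (fun y ↦ 2⁻¹ * (f y + g y)) x u =
      2⁻¹ * (mvfderiv (𝓡 4) f x u + mvfderiv (𝓡 4) g x u) := by
  have h := mvfderiv_mul (mdifferentiableAt_const (c := (2⁻¹ : ℝ))) (hf.add hg)
  have h' := congrArg (fun L ↦ L u) h
  rw [mvfderiv_add hf hg, mvfderiv_const] at h'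
  simp only [smul_apply, add_apply, smul_eq_mul, zero_apply, mul_zero, add_zero] at h'
  exact h'

/-- The Hodge star is parallel. In an oriented orthonormal frame it is given by a constant matrix,
which commutes with the adjoint action of the skew matrix of connection coefficients. -/
theorem covDerivEnd_asdField (hA : IsSmoothEndAt A x) (hs : ∀ y, IsSkew (A y))
    (u : TangentSpace (𝓡 4) x) :
    covDerivEnd (asdField o A hs) x u = asdPart (o.toFun x) (covDerivEnd A x u) := by
  obtain ⟨e, he, ho⟩ := exists_oriented_orthonormal_frame o x
  obtain ⟨b, hb, hbo⟩ := ho.self_of_nhds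
  have hB := isSmoothEndAt_asdField (o := o) hA hs
  have hsB := isSkew_asdField (o := o) hs
  have hF := isSkew_covDerivEnd hA hs u
  obtain ⟨θ, hθ⟩ : ∃ θ : Fin 4 → Fin 4 → ℝ, ∀ i j, θ i j =
    inner ℝ (leviCivita (𝓡 4) M (e i) x u) (e j x) := ⟨_, fun _ _ ↦ rfl⟩
  have θskew (i j : Fin 4) : θ i j = - θ j i := by
    have hei := ContMDiffAt.mdifferentiableAt (he i) (n := ∞) (by simp)
    have hej := ContMDiffAt.mdifferentiableAt (he j) (n := ∞) (by simp)
    have h1 := mvfderiv_metricFun hei hej u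
    have h2 : metricFun (e i) (e j) =ᶠ[𝓝 x] fun _ ↦ if i = j then 1 else 0 := by
      filter_upwards [ho] with y ⟨c, hc, _⟩
      rw [metricFun, ← hc, ← hc, inner_frame]
    rw [mvfderiv_congr h2, mvfderiv_const, zero_apply, real_inner_comm _ (e i x), ← hθ, ← hθ] at h1
    linarith
  have θ0 (i : Fin 4) : θ i i = 0 := by linarith [θskew i i]
  have fA := inner_covDerivEnd_frame hA hs he hb u hθ
  have fB := inner_covDerivEnd_frame hB hsB he hb u hθ
  obtain ⟨k₁, k₂, k₃, k₄, k₅, k₆⟩ := asdPart_frame hbo hF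
  obtain ⟨v₁, v₂, v₃, v₄, v₅, v₆⟩ := entry_asdField (o := o) hs ho.self_of_nhds
  have sA (i j) := congrFun (entry_swap hs e i j) x
  have sB (i j) := congrFun (entry_swap hsB e i j) x
  have d (i j) := ContMDiffAt.mdifferentiableAt (contMDiffAt_entry hA he i j) (n := ∞) (by simp)
  have a0 (i) : entry A e i i x = 0 := by
    have := sA i i
    simp only [Pi.neg_apply] at this
    linarith
  have b0 (i) : entry (asdField o A hs) e i i x = 0 := by
    have := sB i i
    simp only [Pi.neg_apply] at this
    linarith
  have d₁ := mvfderiv_congr (I := 𝓡 4) (ho.mono fun y hy ↦ (entry_asdField (o := o) hs hy).1)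
  have d₂ := mvfderiv_congr (I := 𝓡 4) (ho.mono fun y hy ↦ (entry_asdField (o := o) hs hy).2.1)
  have d₃ := mvfderiv_congr (I := 𝓡 4) (ho.mono fun y hy ↦ (entry_asdField (o := o) hs hy).2.2.1)
  have d₄ := mvfderiv_congr (I := 𝓡 4) (ho.mono fun y hy ↦ (entry_asdField (o := o) hs hy).2.2.2.1)
  have d₅ := mvfderiv_congr (I := 𝓡 4)
    (ho.mono fun y hy ↦ (entry_asdField (o := o) hs hy).2.2.2.2.1)
  have d₆ := mvfderiv_congr (I := 𝓡 4)
    (ho.mono fun y hy ↦ (entry_asdField (o := o) hs hy).2.2.2.2.2)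
  -- Once the derivatives of the entries of `A⁻` are expressed by those of the entries of `A`, both
  -- sides are polynomials in the entries, their derivatives and the connection coefficients.
  refine IsSkew.ext_frame b (isSkew_covDerivEnd hB hsB u) (isSkew_asdPart _ hF)
    ?_ ?_ ?_ ?_ ?_ ?_ <;> [
      rw [fB, k₁, fA, fA, d₁, mvfderiv_half_sub (d 0 1) (d 2 3)];
      rw [fB, k₂, fA, fA, d₂, mvfderiv_half_add (d 0 2) (d 1 3)];
      rw [fB, k₃, fA, fA, d₃, mvfderiv_half_sub (d 0 3) (d 1 2)];
      rw [fB, k₄, fA, fA, d₄, mvfderiv_half_sub (d 1 2) (d 0 3)];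
      rw [fB, k₅, fA, fA, d₅, mvfderiv_half_add (d 1 3) (d 0 2)];
      rw [fB, k₆, fA, fA, d₆, mvfderiv_half_sub (d 2 3) (d 0 1)]] <;>
    simp only [Fin.sum_univ_four, sA 1 0, sA 2 0, sA 3 0, sA 2 1, sA 3 1, sA 3 2, sB 1 0, sB 2 0,
      sB 3 0, sB 2 1, sB 3 1, sB 3 2, Pi.neg_apply, θskew 1 0, θskew 2 0, θskew 3 0, θskew 2 1,
      θskew 3 1, θskew 3 2, θ0, a0, b0, v₁, v₂, v₃, v₄, v₅, v₆] <;>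
    ring

end FourManifolds

/-! ### Killing fields and twistors -/

section Correspondence
variable {M : Type*} [TopologicalSpace M] [ChartedSpace (EuclideanSpace ℝ (Fin 4)) M]
  [IsManifold (𝓡 4) ∞ M]
  [RiemannianBundle (fun x : M ↦ TangentSpace (𝓡 4) x)]
  [IsContMDiffRiemannianBundle (𝓡 4) ∞ (EuclideanSpace ℝ (Fin 4))
    (fun x : M ↦ TangentSpace (𝓡 4) x)]
  {o : ManifoldOrientation M} {x : M}

theorem isSkew_curvature (u v : TangentSpace (𝓡 4) x) : IsSkew (curvature x u v) :=
  inner_curvature_skew u v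

theorem scalarCurvature_of_ricci {c : ℝ}
    (hc : ∀ u v : TangentSpace (𝓡 4) x, ricci x u v = c * inner ℝ u v) :
    scalarCurvature (𝓡 4) x = 4 * c := by
  have h4 : finrank ℝ (TangentSpace (𝓡 4) x) = 4 := Fact.out
  simp [scalarCurvature, hc, h4]

/-- If `Ric = c g`, the Weyl tensor is the difference of the curvature tensor and that of constant
sectional curvature `c / 3`. -/
theorem weyl_eq {c : ℝ} (hc : ∀ u v : TangentSpace (𝓡 4) x, ricci x u v = c * inner ℝ u v)
    (u v : TangentSpace (𝓡 4) x) :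
    weyl x u v = curvature x u v - (c / 3) • ⇑(wedgeHom v u) := by
  have hP (u v : TangentSpace (𝓡 4) x) : schouten x u v = c / 6 * inner ℝ u v := by
    rw [schouten, scalarCurvature_of_ricci hc, hc]
    ring
  have hS (u : TangentSpace (𝓡 4) x) : schoutenSharp x u = (c / 6) • u := by
    simp only [schoutenSharp, hP, mul_smul, ← Finset.smul_sum]
    congr 1
    conv_rhs => rw [← (stdOrthonormalBasis ℝ (TangentSpace (𝓡 4) x)).sum_repr' u]
    exact Finset.sum_congr rfl fun i _ ↦ by rw [real_inner_comm]
  ext w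
  simp only [weyl, hP, hS, Pi.sub_apply, Pi.smul_apply, wedgeHom_apply]
  module

/-- The only use of the curvature hypotheses: `R(u, v)⁻ = (c / 3) (v ∧ u)⁻`. -/
theorem asdPart_curvature (ho : IsSelfdual o) {c : ℝ}
    (hc : ∀ u v : TangentSpace (𝓡 4) x, ricci x u v = c * inner ℝ u v)
    (u v : TangentSpace (𝓡 4) x) :
    asdPart (o.toFun x) (curvature x u v) = (c / 3) • asdPart (o.toFun x) (wedgeHom v u) := by
  have h := ho x u v
  rw [weyl_eq hc, asdPart_sub, sub_eq_zero] at h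
  rw [h]
  ext w
  exact asdPart_smul _ _ _ _

theorem smoothFieldAt_coe
    (K : Cₛ^∞⟮𝓡 4; EuclideanSpace ℝ (Fin 4), (TangentSpace (𝓡 4) : M → Type _)⟯) (x : M) :
    SmoothFieldAt K x := K.contMDiff x

theorem EndField.isSmoothEndAt (Ψ : EndField M) (x : M) : IsSmoothEndAt (I := 𝓡 4) (⇑Ψ) x :=
  fun _ hY ↦ ContMDiffAt.clm_bundle_apply
    (F₁ := EuclideanSpace ℝ (Fin 4)) (F₂ := EuclideanSpace ℝ (Fin 4))
    (E₁ := fun x : M ↦ TangentSpace (𝓡 4) x) (E₂ := fun x : M ↦ TangentSpace (𝓡 4) x)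
    (b := fun y ↦ y) (Ψ.contMDiff x) hY

/-- The vector field dual to a smooth 1-form is smooth. -/
theorem smoothFieldAt_sharp (γ : OneForm M) (x : M) : SmoothFieldAt (fun y ↦ sharp (γ y)) x := by
  refine contMDiffAt_of_metricFun (I := 𝓡 4) fun Z hZ ↦ ?_
  have h : metricFun (fun y ↦ sharp (γ y)) Z = fun y ↦ γ y (Z y) := by
    ext y
    exact inner_sharp _ _
  rw [h]
  have := ContMDiffAt.clm_bundle_apply (n := ∞)
    (F₁ := EuclideanSpace ℝ (Fin 4)) (F₂ := ℝ)
    (E₁ := fun x : M ↦ TangentSpace (𝓡 4) x) (E₂ := Bundle.Trivial M ℝ)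
    (b := fun y ↦ y) (γ.contMDiff x) hZ
  rw [contMDiffAt_section] at this
  exact this

/-- The 1-form `K♭ = g(K, ·)`. -/
def flat (K : Cₛ^∞⟮𝓡 4; EuclideanSpace ℝ (Fin 4), (TangentSpace (𝓡 4) : M → Type _)⟯) :
    OneForm M where
  toFun y := innerSL ℝ (K y)
  contMDiff_toFun x := contMDiffAt_hom_section (V := Bundle.Trivial M ℝ) fun Y hY ↦ by
    rw [contMDiffAt_section]
    exact contMDiffAt_metricFun (smoothFieldAt_coe K x) hY

theorem sharp_flat (K : Cₛ^∞⟮𝓡 4; EuclideanSpace ℝ (Fin 4), (TangentSpace (𝓡 4) : M → Type _)⟯)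
    (x : M) : sharp (flat K x) = K x :=
  ext_inner_right ℝ fun v ↦ inner_sharp _ v

/-- The antiselfdual part of `DK`, for a Killing field `K`, as a smooth endomorphism field. -/
def asdDeriv (o : ManifoldOrientation M) (K : killingFields (𝓡 4) M) : EndField M where
  toFun := asdField o (leviCivita (𝓡 4) M K.1) K.2
  contMDiff_toFun x := contMDiffAt_hom_section <|
    isSmoothEndAt_asdField (fun _ hY ↦ contMDiffAt_leviCivita hY (smoothFieldAt_coe K.1 x)) K.2

theorem asdDeriv_apply (K : killingFields (𝓡 4) M) (x : M) :
    ⇑(asdDeriv o K x) = asdPart (o.toFun x) (leviCivita (𝓡 4) M K.1 x) := rfl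

/-- Since `A ↦ A⁻` is parallel and `D²_{u,v} K = R(u, K) v`, it follows that
`D_u (DK)⁻ = R(u, K)⁻ = (c / 3) (K ∧ u)⁻`. -/
theorem covDerivEnd_asdDeriv (ho : IsSelfdual o) {c : ℝ}
    (hc : ∀ u v : TangentSpace (𝓡 4) x, ricci x u v = c * inner ℝ u v)
    (K : killingFields (𝓡 4) M) (u : TangentSpace (𝓡 4) x) :
    covDerivEnd (asdDeriv o K) x u = (c / 3) • asdPart (o.toFun x) (wedgeHom (K.1 x) u) := by
  have hK := smoothFieldAt_coe K.1 x
  have h : covDerivEnd (asdDeriv o K) x u =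
      asdPart (o.toFun x) (covDerivEnd (leviCivita (𝓡 4) M K.1) x u) :=
    covDerivEnd_asdField (fun _ hY ↦ contMDiffAt_leviCivita hY hK) K.2 u
  have h' : covDerivEnd (leviCivita (𝓡 4) M K.1) x u = curvature x u (K.1 x) := by
    ext v
    exact covDerivEnd_leviCivita_of_killing hK K.2 u v
  rw [h, h', asdPart_curvature ho hc]

theorem isTwistor_asdDeriv (ho : IsSelfdual o) {c : ℝ}
    (hc : ∀ (x : M) (u v : TangentSpace (𝓡 4) x), ricci x u v = c * inner ℝ u v)
    (K : killingFields (𝓡 4) M) : IsTwistor o (asdDeriv o K) where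
  skew := isSkew_asdField K.2
  antiselfdual x u := congrFun (hodgeStar_asdPart (o := o.toFun x) (K.2 x)) u
  twistor_equation := ⟨(c / 3) • flat K.1, fun x u v ↦ by
    have h : wedge (((c / 3) • flat K.1) x) u = (c / 3) • ⇑(wedgeHom (K.1 x) u) := by
      ext w
      rw [← sharp_flat, ← wedge_eq_wedgeHom]
      exact wedge_smul _ _ _ _
    rw [covDerivEnd_asdDeriv ho (hc x), h, asdPart_smul, Pi.smul_apply]⟩

variable (o) in
/-- The linear map `K ↦ (DK)⁻` from Killing fields to twistors. -/
def twistorMap (ho : IsSelfdual o) {c : ℝ}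
    (hc : ∀ (x : M) (u v : TangentSpace (𝓡 4) x), ricci x u v = c * inner ℝ u v) :
    killingFields (𝓡 4) M →ₗ[ℝ] twistors o where
  toFun K := ⟨asdDeriv o K, isTwistor_asdDeriv ho hc K⟩
  map_add' K K' := by
    refine Subtype.ext (ContMDiffSection.ext fun x ↦ ContinuousLinearMap.ext fun u ↦ ?_)
    have h : ⇑(leviCivita (𝓡 4) M (K + K').1 x) =
        leviCivita (𝓡 4) M K.1 x + leviCivita (𝓡 4) M K'.1 x := by
      ext u
      exact leviCivita_add (ContMDiffAt.mdifferentiableAt (smoothFieldAt_coe K.1 x) (by simp))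
        (ContMDiffAt.mdifferentiableAt (smoothFieldAt_coe K'.1 x) (by simp)) u
    have h' := congrFun (asdDeriv_apply (o := o) (K + K') x) u
    rw [h] at h'
    exact h'.trans (asdPart_add _ _ _ _)
  map_smul' r K := by
    refine Subtype.ext (ContMDiffSection.ext fun x ↦ ContinuousLinearMap.ext fun u ↦ ?_)
    have h : ⇑(leviCivita (𝓡 4) M (r • K).1 x) = r • ⇑(leviCivita (𝓡 4) M K.1 x) := by
      ext u
      exact leviCivita_const_smul r
        (ContMDiffAt.mdifferentiableAt (smoothFieldAt_coe K.1 x) (by simp)) u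
    have h' := congrFun (asdDeriv_apply (o := o) (r • K) x) u
    rw [h] at h'
    exact h'.trans (asdPart_smul _ _ _ _)

/-- A Killing field `K` is determined by `(DK)⁻`, since `D_u (DK)⁻ = (c / 3) (K ∧ u)⁻`. The
hypothesis on `c` is relative to a point of `M`, because `Ric = c g` holds for every `c` if `M` is
empty. -/
theorem twistorMap_injective (ho : IsSelfdual o) {c : ℝ}
    (hc : ∀ (x : M) (u v : TangentSpace (𝓡 4) x), ricci x u v = c * inner ℝ u v)
    (h0 : ∀ _ : M, c ≠ 0) : Function.Injective (twistorMap o ho hc) := by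
  rw [injective_iff_map_eq_zero]
  intro K hK
  refine Subtype.ext (ContMDiffSection.ext fun x ↦ ?_)
  have hΨ : asdDeriv o K = 0 := congrArg Subtype.val hK
  refine eq_zero_of_asdPart_wedgeHom_eq_zero (o := o.toFun x) fun u ↦ ?_
  have h := covDerivEnd_asdDeriv ho (hc x) K u
  have hz : covDerivEnd (0 : EndField M) x u = 0 := by
    ext v
    have h1 : leviCivita (𝓡 4) M (0 : Π y : M, TangentSpace (𝓡 4) y) x u = 0 := by
      have : leviCivita (𝓡 4) M (0 : Π y : M, TangentSpace (𝓡 4) y) = 0 :=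
        CovariantDerivative.zero _
      rw [this]
      rfl
    have h2 : covDerivEnd (0 : EndField M) x u v =
        leviCivita (𝓡 4) M (0 : Π y : M, TangentSpace (𝓡 4) y) x u - 0 := rfl
    rw [h2, h1, sub_zero, Pi.zero_apply]
  rw [hΨ, hz] at h
  exact (smul_eq_zero.mp h.symm).resolve_left (div_ne_zero (h0 x) (by norm_num))

/-- The integrability condition of the twistor equation `D_u Ψ = (G ∧ u)⁻`, obtained by inserting
the equation into the Ricci identity for the second covariant derivatives of `Ψ`. -/
theorem asdPart_wedgeHom_sub_eq_curvature
    {Ψ : Π y : M, TangentSpace (𝓡 4) y →L[ℝ] TangentSpace (𝓡 4) y}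
    (hΨ : ∀ y, IsSmoothEndAt Ψ y) (hs : ∀ y, IsSkew (Ψ y))
    {G : Π y : M, TangentSpace (𝓡 4) y}
    (hG : SmoothFieldAt G x)
    (h : ∀ y u, covDerivEnd Ψ y u = asdPart (o.toFun y) (wedgeHom (G y) u))
    (u v w : TangentSpace (𝓡 4) x) :
    asdPart (o.toFun x) (wedgeHom (leviCivita (𝓡 4) M G x u) v -
      wedgeHom (leviCivita (𝓡 4) M G x v) u) w =
      curvature x u v (Ψ x w) - Ψ x (curvature x u v w) := by
  have hex (u : TangentSpace (𝓡 4) x) :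
      SmoothFieldAt (extend (EuclideanSpace ℝ (Fin 4)) u) x := contMDiffAt_extend ..
  have hdiff (u : TangentSpace (𝓡 4) x) :=
    ContMDiffAt.mdifferentiableAt (hex u) (n := ∞) (by simp)
  have key (u v w : TangentSpace (𝓡 4) x) :
      leviCivita (𝓡 4) M (fun y ↦ covDerivEnd Ψ y (extend (EuclideanSpace ℝ (Fin 4)) v y)
        (extend (EuclideanSpace ℝ (Fin 4)) w y)) x u =
      asdPart (o.toFun x) (wedgeHom (leviCivita (𝓡 4) M G x u) v) w +
      asdPart (o.toFun x)
        (wedgeHom (G x) (leviCivita (𝓡 4) M (extend (EuclideanSpace ℝ (Fin 4)) v) x u)) w +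
      asdPart (o.toFun x) (wedgeHom (G x) v)
        (leviCivita (𝓡 4) M (extend (EuclideanSpace ℝ (Fin 4)) w) x u) := by
    have hA := isSmoothEndAt_wedgeHom (I := 𝓡 4) hG (hex v)
    have hsA : ∀ y, IsSkew (wedgeHom (G y) (extend (EuclideanSpace ℝ (Fin 4)) v y)) :=
      fun y ↦ isSkew_wedgeHom _ _
    have hB := isSmoothEndAt_asdField (o := o) hA hsA
    have e : (fun y ↦ covDerivEnd Ψ y (extend (EuclideanSpace ℝ (Fin 4)) v y)
        (extend (EuclideanSpace ℝ (Fin 4)) w y)) =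
        fun y ↦ asdField o _ hsA y (extend (EuclideanSpace ℝ (Fin 4)) w y) := by
      ext1 y
      rw [h]
      rfl
    have e' : covDerivEnd (fun y ↦ wedgeHom (G y) (extend (EuclideanSpace ℝ (Fin 4)) v y)) x u =
        ⇑(wedgeHom (leviCivita (𝓡 4) M G x u) v) +
          ⇑(wedgeHom (G x) (leviCivita (𝓡 4) M (extend (EuclideanSpace ℝ (Fin 4)) v) x u)) := by
      ext w
      rw [covDerivEnd_wedgeHom hG (hex v), extend_apply_self]
      rfl
    rw [e, leviCivita_end_apply hB (isSkew_asdField hsA) (hdiff w)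
      (ContMDiffAt.mdifferentiableAt (hB _ (hex w)) (n := ∞) (by simp)),
      covDerivEnd_asdField hA hsA, e', asdPart_add, extend_apply_self]
    simp only [asdField, asdHom_apply, extend_apply_self]
  have hR := curvature_commutator hΨ hs (hex u) (hex v) (hex w)
  have htor := leviCivita_sub_leviCivita (hdiff u) (hdiff v)
  rw [← htor] at hR
  simp only [extend_apply_self] at hR
  rw [hR, key, key, h, h, h, asdPart_sub, Pi.sub_apply]
  have lin (a b : TangentSpace (𝓡 4) x) : asdPart (o.toFun x) (wedgeHom (G x) (a - b)) w =
      asdPart (o.toFun x) (wedgeHom (G x) a) w - asdPart (o.toFun x) (wedgeHom (G x) b) w := by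
    have : ⇑(wedgeHom (G x) (a - b)) = ⇑(wedgeHom (G x) a) - ⇑(wedgeHom (G x) b) := by
      ext z
      simp only [Pi.sub_apply, wedgeHom_apply, inner_sub_left]
      module
    rw [this, asdPart_sub, Pi.sub_apply]
  -- The terms with `D_u V`, `D_v U` and `[U, V]` cancel, as `D` has no torsion.
  rw [lin]
  abel

/-- If `D_u Ψ = (γ ∧ u)⁻`, then `(3 / c) ♯γ` is a Killing field mapped to `Ψ`. -/
theorem twistorMap_surjective (ho : IsSelfdual o) {c : ℝ}
    (hc : ∀ (x : M) (u v : TangentSpace (𝓡 4) x), ricci x u v = c * inner ℝ u v)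
    (h0 : ∀ _ : M, c ≠ 0) : Function.Surjective (twistorMap o ho hc) := by
  rintro ⟨Ψ, hs, hasd, γ, hγ⟩
  have hG (x : M) : SmoothFieldAt (fun y ↦ sharp (γ y)) x := smoothFieldAt_sharp γ x
  have hΨ (y : M) (u : TangentSpace (𝓡 4) y) :
      covDerivEnd Ψ y u = asdPart (o.toFun y) (wedgeHom (sharp (γ y)) u) := by
    ext v
    rw [hγ, wedge_eq_wedgeHom]
  have key (x : M) := isSkew_and_asdPart_eq_of_commutator (o := o.toFun x) (Ψ := Ψ x)
    (leviCivita (𝓡 4) M (fun y ↦ sharp (γ y)) x :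
      TangentSpace (𝓡 4) x →ₗ[ℝ] TangentSpace (𝓡 4) x)
    (curvature x) (c / 3) (hs x) (funext (hasd x)) isSkew_curvature (asdPart_curvature ho (hc x))
    (asdPart_wedgeHom_sub_eq_curvature Ψ.isSmoothEndAt hs (hG x) hΨ)
  let K : Cₛ^∞⟮𝓡 4; EuclideanSpace ℝ (Fin 4), (TangentSpace (𝓡 4) : M → Type _)⟯ :=
    (c / 3)⁻¹ • ⟨fun y ↦ sharp (γ y), hG⟩
  have hK (x : M) : ⇑(leviCivita (𝓡 4) M K x) =
      (c / 3)⁻¹ • ⇑(leviCivita (𝓡 4) M (fun y ↦ sharp (γ y)) x) := by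
    ext u
    exact leviCivita_const_smul _ (ContMDiffAt.mdifferentiableAt (hG x) (by simp)) u
  have hKs (x : M) : IsSkew (leviCivita (𝓡 4) M K x) := by
    rw [hK]
    exact (key x).1.smul _
  refine ⟨⟨K, hKs⟩, Subtype.ext (ContMDiffSection.ext fun x ↦ ContinuousLinearMap.ext fun u ↦ ?_)⟩
  have h1 := congrFun (asdDeriv_apply (o := o) ⟨K, hKs⟩ x) u
  have h2 := congrFun (key x).2 u
  refine h1.trans ?_
  rw [hK, asdPart_smul]
  refine (congrArg ((c / 3)⁻¹ • ·) h2).trans ?_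
  exact inv_smul_smul₀ (div_ne_zero (h0 x) (by norm_num)) _

end Correspondence

end SelfdualEinstein
end

theorem mainTheorem5
    {M : Type*} [TopologicalSpace M] [ChartedSpace (EuclideanSpace ℝ (Fin 4)) M]
    [IsManifold (𝓡 4) ∞ M]
    [RiemannianBundle (fun x : M ↦ TangentSpace (𝓡 4) x)]
    [IsContMDiffRiemannianBundle (𝓡 4) ∞ (EuclideanSpace ℝ (Fin 4))
      (fun x : M ↦ TangentSpace (𝓡 4) x)]
    (o : SelfdualEinstein.ManifoldOrientation M)
    (hEinstein : SelfdualEinstein.IsEinstein (𝓡 4) M)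
    (hSelfdual : SelfdualEinstein.IsSelfdual o)
    (hScal : ∀ x : M, SelfdualEinstein.scalarCurvature (𝓡 4) x ≠ 0) :
    ∃ Θ : SelfdualEinstein.killingFields (𝓡 4) M ≃ₗ[ℝ] SelfdualEinstein.twistors o,
      ∀ (K : SelfdualEinstein.killingFields (𝓡 4) M) (x : M) (u : TangentSpace (𝓡 4) x),
        (Θ K : SelfdualEinstein.EndField M) x u =
          SelfdualEinstein.asdPart (o.toFun x)
            (SelfdualEinstein.leviCivita (𝓡 4) M
              (K : Cₛ^∞⟮𝓡 4; EuclideanSpace ℝ (Fin 4), (TangentSpace (𝓡 4) : M → Type _)⟯) x) u := by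
  obtain ⟨c, hc⟩ := hEinstein
  have h0 (x : M) : c ≠ 0 := by
    rintro rfl
    exact hScal x (by rw [SelfdualEinstein.scalarCurvature_of_ricci (hc x), mul_zero])
  exact ⟨LinearEquiv.ofBijective (SelfdualEinstein.twistorMap o hSelfdual hc)
    ⟨SelfdualEinstein.twistorMap_injective hSelfdual hc h0,
      SelfdualEinstein.twistorMap_surjective hSelfdual hc h0⟩, fun _ _ _ ↦ rfl⟩
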